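/- **Conventions.** A *topo-semigroup* is a semigroup $G$ with a topology such that: (i) $G$ is separable and metrizable, and for a compatible metric $G$ is a Borel subset of its completion; (ii) the multiplication $G\times G\to G$ is a Borel map; (iii) $G$ contains a unit $1$, and $x_n y z_n\to y$ whenever $x_n\to 1$, $z_n\to 1$ and $y\in G$. A *weakly continuous convolution semigroup* in $G$ is a family $(\mu_t)_{t>0}$ of Borel probability measures on $G$ such that $\mu_s*\mu_t=\mu_{s+t}$ for all $s,t>0$ (where $\mu*\nu$ is the image of $\mu\times\nu$ under $(x,y)\mapsto xy$) and $\mu_t(U)\to1$ as $t\to0+$ for every neighborhood $U$ of $1$. All probability spaces $(\Omega,\mathcal F,P)$ are standard; all sub-$\sigma$-fields are understood to contain all negligible events; $\operatorname{Aut}(\Omega)$ is the group of measure preserving, a.e. invertible transformations of $\Omega$ modulo a.e. equality, with its usual topology (induced by the maps $T\mapsto T^{-1}(A)$, $A\in\mathcal F$, into the measure algebra with the metric $P(A\,\triangle\,B)$). A *measurable action* of $\mathbb R$ on $\Omega$ is a Borel measurable homomorphism $h\mapsto T_h$ from $(\mathbb R,+)$ to $\operatorname{Aut}(\Omega)$.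 A *noise* consists of a probability space $(\Omega,\mathcal F,P)$, sub-$\sigma$-fields $\mathcal F_{s,t}\subset\mathcal F$ ($s<t$ real) and a measurable action $(T_h)_{h\in\mathbb R}$ of $\mathbb R$ on $\Omega$ such that for $r<s<t$ the $\sigma$-fields $\mathcal F_{r,s}$ and $\mathcal F_{s,t}$ are independent and together generate $\mathcal F_{r,t}$; $T_h$ sends $\mathcal F_{s,t}$ to $\mathcal F_{s+h,t+h}$ (that is, $\mathcal F_{s+h,t+h}$ consists, up to negligible events, of the events $T_h^{-1}(A)$, $A\in\mathcal F_{s,t}$) for all $s<t$ and $h$; and $\mathcal F$ is generated by the union of all $\mathcal F_{s,t}$. **Proposition.** Let $G$ be a topo-semigroup and $(\mu_t)_{t>0}$ a weakly continuous convolution semigroup in $G$. 1. There exist a standard probability space $(\Omega,\mathcal F,P)$ and a family $(X_{s,t})_{-\infty<s<t<\infty}$ of $G$-valued random variables on it such that (a) $X_{s,t}$ is distributed $\mu_{t-s}$ whenever $s<t$; (b) $X_{t_1,t_2},X_{t_2,t_3},\dots,X_{t_{n-1},t_n}$ are independent for $t_1<t_2<\dots<t_n$; (c) $X_{r,t}=X_{r,s}X_{s,t}$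 a.s. whenever $r<s<t$; (d) $X_{s_n,t_n}\to X_{s,t}$ in probability whenever $s<t$, $s_n\uparrow s$ and $t_n\downarrow t$; and $\mathcal F$ is generated, up to negligible events, by all the $X_{s,t}$. 2. Every such family leads to a noise. Namely, let $(X_{s,t})_{s<t}$ be any family of $G$-valued random variables on a standard probability space $(\Omega,\mathcal F,P)$ that satisfies (a)–(d) and generates $\mathcal F$ up to negligible events, and let $\mathcal F_{s,t}$ be the $\sigma$-field generated by all $X_{u,v}$ with $s\le u<v\le t$ and the negligible events. Then there is one and only one homomorphism $h\mapsto T_h$ from $\mathbb R$ to $\operatorname{Aut}(\Omega)$ such that $X_{s,t}\circ T_h=X_{s+h,t+h}$ a.s. for all $s<t$ and $h\in\mathbb R$, and $\big((\Omega,\mathcal F,P),(\mathcal F_{s,t})_{s<t},(T_h)_{h\in\mathbb R}\big)$ is a noise; in particular, the time-shift action is measurable. -/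

import Mathlib

open MeasureTheory ProbabilityTheory Filter Topology

universe u v

noncomputable section

/-! ### Topo-semigroups and convolution semigroups -/

/-- The image of a uniform space in its completion is a Borel set. -/
def IsBorelInCompletion (G : Type u) [UniformSpace G] : Prop :=
  MeasurableSet[borel (UniformSpace.Completion G)]
    (Set.range ((↑) : G → UniformSpace.Completion G))

/-- A topo-semigroup: a semigroup with unit and a separable metrizable topology for which `G` is
Borel in its completion (for some compatible metric), whose multiplication is a Borel map, and
such that `x n * y * z n → y` whenever `x n → 1` and `z n → 1`. -/
structure IsTopoSemigroup (G : Type u) [Monoid G] [t : TopologicalSpace G]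
    [MeasurableSpace G] [BorelSpace G] : Prop where
  separable : TopologicalSpace.SeparableSpace G
  borel_in_completion : ∃ m : MetricSpace G,
    m.toUniformSpace.toTopologicalSpace = t ∧ @IsBorelInCompletion G m.toUniformSpace
  measurable_mul : Measurable (fun p : G × G => p.1 * p.2)
  tendsto_mul : ∀ (x z : ℕ → G) (y : G), Tendsto x atTop (𝓝 1) → Tendsto z atTop (𝓝 1) →
    Tendsto (fun n => x n * y * z n) atTop (𝓝 y)

/-- A weakly continuous convolution semigroup `(μ t)`, `t > 0` (the values of `μ` at `t ≤ 0` are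
irrelevant). -/
structure IsWeaklyContinuousConvolutionSemigroup {G : Type u} [Monoid G] [TopologicalSpace G]
    [MeasurableSpace G] (μ : ℝ → Measure G) : Prop where
  isProbabilityMeasure : ∀ t : ℝ, 0 < t → IsProbabilityMeasure (μ t)
  conv : ∀ s t : ℝ, 0 < s → 0 < t → Measure.mconv (μ s) (μ t) = μ (s + t)
  weak_continuity : ∀ U ∈ 𝓝 (1 : G), Tendsto (fun t => μ t U) (𝓝[>] 0) (𝓝 1)

/-! ### Stationary flows -/

/-- Convergence in probability of random variables with values in a metrizable space: convergence
in probability with respect to every metric compatible with the topology. -/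
def TendstoInProbability {Ω : Type v} [MeasurableSpace Ω] {G : Type u} [t : TopologicalSpace G]
    (P : Measure Ω) (Y : ℕ → Ω → G) (Z : Ω → G) : Prop :=
  ∀ m : MetricSpace G, m.toUniformSpace.toTopologicalSpace = t →
    ∀ ε : ℝ, 0 < ε →
      Tendsto (fun n => P {ω | ε ≤ m.dist (Y n ω) (Z ω)}) atTop (𝓝 0)

/-- `X s t`, `s < t`, is a stationary `G`-flow on `(Ω, P)` corresponding to the convolution
semigroup `μ` (the values of `X s t` for `t ≤ s` are irrelevant). -/
structure IsStationaryFlow {Ω : Type v} [MeasurableSpace Ω] {G : Type u} [Monoid G]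
    [TopologicalSpace G] [MeasurableSpace G] (μ : ℝ → Measure G) (P : Measure Ω)
    (X : ℝ → ℝ → Ω → G) : Prop where
  measurable : ∀ s t : ℝ, s < t → Measurable (X s t)
  law : ∀ s t : ℝ, s < t → P.map (X s t) = μ (t - s)
  indep : ∀ (n : ℕ) (τ : Fin (n + 1) → ℝ), StrictMono τ →
    iIndepFun (fun (i : Fin n) => X (τ i.castSucc) (τ i.succ)) P
  mul : ∀ r s t : ℝ, r < s → s < t → X r t =ᵐ[P] fun ω => X r s ω * X s t ω
  continuity : ∀ (s t : ℝ) (s' t' : ℕ → ℝ), s < t →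
    Monotone s' → Tendsto s' atTop (𝓝 s) → Antitone t' → Tendsto t' atTop (𝓝 t) →
    TendstoInProbability P (fun n => X (s' n) (t' n)) (X s t)

/-! ### Sub-σ-fields; all of them contain the negligible events -/

/-- The σ-field generated by the negligible events. -/
abbrev negligibleSigma {Ω : Type v} [MeasurableSpace Ω] (P : Measure Ω) : MeasurableSpace Ω :=
  MeasurableSpace.generateFrom {N | MeasurableSet N ∧ P N = 0}

/-- The σ-field generated by the `X u v` with `s ≤ u < v ≤ t` and by the negligible events. -/
abbrev flowSigma {Ω : Type v} [MeasurableSpace Ω] {G : Type u} [mG : MeasurableSpace G]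
    (P : Measure Ω) (X : ℝ → ℝ → Ω → G) (s t : ℝ) : MeasurableSpace Ω :=
  (⨆ (a : ℝ) (b : ℝ) (_ : s ≤ a ∧ a < b ∧ b ≤ t), mG.comap (X a b)) ⊔ negligibleSigma P

/-- Non-redundancy: the whole σ-field of `Ω` is generated, up to negligible events, by all the
`X s t`, `s < t`. -/
def IsNonredundant {Ω : Type v} [mΩ : MeasurableSpace Ω] {G : Type u} [mG : MeasurableSpace G]
    (P : Measure Ω) (X : ℝ → ℝ → Ω → G) : Prop :=
  (⨆ (a : ℝ) (b : ℝ) (_ : a < b), mG.comap (X a b)) ⊔ negligibleSigma P = mΩ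

/-! ### The automorphism group of a probability space -/

/-- A measure preserving map `Ω → Ω` together with an almost everywhere inverse that is also
measure preserving. -/
structure PreAut {Ω : Type v} [MeasurableSpace Ω] (P : Measure Ω) where
  toFun : Ω → Ω
  invFun : Ω → Ω
  measurePreserving_toFun : MeasurePreserving toFun P P
  measurePreserving_invFun : MeasurePreserving invFun P P
  left_inv : (fun ω => invFun (toFun ω)) =ᵐ[P] fun ω => ω
  right_inv : (fun ω => toFun (invFun ω)) =ᵐ[P] fun ω => ω

namespace PreAut

variable {Ω : Type v} [MeasurableSpace Ω] {P : Measure Ω}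

/-- Equality almost everywhere. -/
instance setoid (P : Measure Ω) : Setoid (PreAut P) where
  r f g := f.toFun =ᵐ[P] g.toFun
  iseqv := ⟨fun _ => EventuallyEq.rfl, fun h => h.symm, fun h h' => h.trans h'⟩

/-- The identity. -/
def one : PreAut P where
  toFun := fun ω => ω
  invFun := fun ω => ω
  measurePreserving_toFun := MeasurePreserving.id P
  measurePreserving_invFun := MeasurePreserving.id P
  left_inv := EventuallyEq.rfl
  right_inv := EventuallyEq.rfl

/-- Composition. -/
def mul (f g : PreAut P) : PreAut P where
  toFun := fun ω => f.toFun (g.toFun ω)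
  invFun := fun ω => g.invFun (f.invFun ω)
  measurePreserving_toFun := f.measurePreserving_toFun.comp g.measurePreserving_toFun
  measurePreserving_invFun := g.measurePreserving_invFun.comp f.measurePreserving_invFun
  left_inv := by
    have h := g.measurePreserving_toFun.quasiMeasurePreserving.ae f.left_inv
    filter_upwards [h, g.left_inv] with ω h1 h2
    rw [h1, h2]
  right_inv := by
    have h := f.measurePreserving_invFun.quasiMeasurePreserving.ae g.right_inv
    filter_upwards [h, f.right_inv] with ω h1 h2
    rw [h1, h2]

/-- The inverse. -/
def inv (f : PreAut P) : PreAut P where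
  toFun := f.invFun
  invFun := f.toFun
  measurePreserving_toFun := f.measurePreserving_invFun
  measurePreserving_invFun := f.measurePreserving_toFun
  left_inv := f.right_inv
  right_inv := f.left_inv

theorem mul_congr {f f' g g' : PreAut P} (hf : f ≈ f') (hg : g ≈ g') :
    mul f g ≈ mul f' g' := by
  have h := g.measurePreserving_toFun.quasiMeasurePreserving.ae hf
  change (fun ω => f.toFun (g.toFun ω)) =ᵐ[P] fun ω => f'.toFun (g'.toFun ω)
  filter_upwards [h, hg] with ω h1 h2
  rw [h1, h2]

theorem inv_congr {f g : PreAut P} (h : f ≈ g) : inv f ≈ inv g := by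
  have h1 := g.measurePreserving_invFun.quasiMeasurePreserving.ae h
  have h2 := g.measurePreserving_invFun.quasiMeasurePreserving.ae f.left_inv
  change f.invFun =ᵐ[P] g.invFun
  filter_upwards [h1, h2, g.right_inv] with ω h1 h2 h3
  rw [h3] at h1
  rw [h1] at h2
  exact h2

end PreAut

/-- The automorphism group `Aut(Ω)`: measure preserving, almost everywhere invertible
transformations, modulo equality almost everywhere. -/
def MeasAut {Ω : Type v} [MeasurableSpace Ω] (P : Measure Ω) : Type v :=
  Quotient (PreAut.setoid P)

namespace MeasAut

variable {Ω : Type v} [MeasurableSpace Ω] {P : Measure Ω}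

instance : Group (MeasAut P) where
  mul := Quotient.map₂ PreAut.mul (fun _ _ hf _ _ hg => PreAut.mul_congr hf hg)
  one := Quotient.mk _ PreAut.one
  inv := Quotient.map PreAut.inv (fun _ _ h => PreAut.inv_congr h)
  mul_assoc := by
    rintro ⟨f⟩ ⟨g⟩ ⟨h⟩
    rfl
  one_mul := by
    rintro ⟨f⟩
    rfl
  mul_one := by
    rintro ⟨f⟩
    rfl
  inv_mul_cancel := by
    rintro ⟨f⟩
    exact Quotient.sound f.left_inv

/-- A map representing an automorphism (it is determined up to equality almost everywhere). -/
def rep (T : MeasAut P) : Ω → Ω := (Quotient.out T).toFun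

/-- The usual (weak) topology of `Aut(Ω)`: the topology induced by the maps `T ↦ T⁻¹(A)`, `A` an
event, into the measure algebra with the metric `P (A ∆ B)`. -/
instance : TopologicalSpace (MeasAut P) :=
  TopologicalSpace.generateFrom
    {V | ∃ (S : MeasAut P) (A : Set Ω) (ε : ENNReal), MeasurableSet A ∧ 0 < ε ∧
      V = {T | P (symmDiff (T.rep ⁻¹' A) (S.rep ⁻¹' A)) < ε}}

end MeasAut

/-- The sub-σ-field to which an automorphism `T` sends a sub-σ-field `m`; it consists, up to
negligible events, of the events `T⁻¹(A)`, `A ∈ m`. -/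
abbrev MeasAut.mapSigma {Ω : Type v} {mΩ : MeasurableSpace Ω} {P : Measure Ω} (T : MeasAut P)
    (m : MeasurableSpace Ω) : MeasurableSpace Ω :=
  m.comap (@MeasAut.rep Ω mΩ P T) ⊔ @negligibleSigma Ω mΩ P

/-- A measurable action of `ℝ` on a probability space: a homomorphism from `(ℝ, +)` to `Aut(Ω)`
that is Borel measurable. -/
def IsMeasurableAction {Ω : Type v} [MeasurableSpace Ω] {P : Measure Ω}
    (T : Multiplicative ℝ →* MeasAut P) : Prop :=
  Measurable[borel ℝ, borel (MeasAut P)] fun h : ℝ => T (Multiplicative.ofAdd h)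

/-! ### Noises -/

/-- A noise: sub-σ-fields `F s t`, `s < t`, of a probability space together with a measurable
action `T` of `ℝ` (the time shifts). -/
structure IsNoise {Ω : Type v} [mΩ : MeasurableSpace Ω] (P : Measure Ω)
    (F : ℝ → ℝ → MeasurableSpace Ω) (T : Multiplicative ℝ →* MeasAut P) : Prop where
  le : ∀ s t : ℝ, s < t → F s t ≤ mΩ
  negligible_le : ∀ s t : ℝ, s < t → negligibleSigma P ≤ F s t
  measurable_action : IsMeasurableAction T
  indep : ∀ r s t : ℝ, r < s → s < t → Indep (F r s) (F s t) P
  generate : ∀ r s t : ℝ, r < s → s < t → F r s ⊔ F s t = F r t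
  shift : ∀ s t h : ℝ, s < t →
    (T (Multiplicative.ofAdd h)).mapSigma (F s t) = F (s + h) (t + h)
  nonredundant : (⨆ (s : ℝ) (t : ℝ) (_ : s < t), F s t) = mΩ

end

/-! Existence. Cutting time at finitely many points turns every `X s t` into an ordered product of
consecutive increments, so all finite-dimensional laws are images of product measures and are
determined by `μ` (`IsFlowOn.map_eq_map`). They form a projective family, and since `G` is standard
Borel, Kolmogorov's theorem yields a flow over all pairs `s < t` (`exists_isFlowOn_univ`).
Continuity is then automatic: an interval slightly larger than `[s, t]` multiplies `X s t` on both
sides by factors close to `1` in probability, and the topo-semigroup axiom applies along a.e.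
convergent subsequences (`IsFlowOn.tendstoInProbability`). Hence the values at rational times
determine all others almost surely, and the flow can be moved to a countable power of `G`, which is
standard.

Shifts. By non-redundancy a point `ω` is almost surely a measurable function `Ψ` of the rational
values of the flow at `ω`. The shift by `h` must therefore be `Ψ` applied to the rational values of
the shifted flow; it preserves the measure because both flows have the same law. Uniqueness makes
the shifts a group.

Measurability of the action. Continuity in probability is known only for intervals shrinking from
outside. Rounding the endpoints of the shifted intervals outward to a grid gives functions of `h`
that factor through integers and converge for each `h`, so the laws of the shifted flow restricted
to any event depend measurably on `h`. Such pairings with events suffice, since countably many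
approximation conditions generate a topology on the automorphism group at least as fine as the weak
one (`MeasAut.measurable_borel_of_measure_inter`). -/

open scoped NNReal BoundedContinuousFunction

namespace MeasureTheory

/-! ### Kolmogorov extension -/

section Kolmogorov

variable {G : Type*} [MeasurableSpace G] [StandardBorelSpace G] [Nonempty G]

/-- **Kolmogorov extension theorem** for sequences in a standard Borel space. -/
theorem exists_isProjectiveLimit_nat (P : ∀ J : Finset ℕ, Measure (J → G))
    [∀ J, IsProbabilityMeasure (P J)] (hP : IsProjectiveMeasureFamily (α := fun _ => G) P) :
    ∃ ν : Measure (ℕ → G), IsProjectiveLimit (α := fun _ => G) ν P := by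
  let last (n : ℕ) (x : Finset.Iic (n + 1) → G) : G := x ⟨n + 1, by simp⟩
  have hlast (n : ℕ) : Measurable (last n) := measurable_pi_apply _
  let init (n : ℕ) (x : Finset.Iic (n + 1) → G) : Finset.Iic n → G :=
    Preorder.frestrictLe₂ (π := fun _ => G) n.le_succ x
  have hinit (n : ℕ) : Measurable (init n) :=
    measurable_pi_lambda _ fun _ => measurable_pi_apply _
  let ρ (n : ℕ) : Measure ((Finset.Iic n → G) × G) :=
    (P (Finset.Iic (n + 1))).map fun x => (init n x, last n x)
  have hρ (n : ℕ) : IsProbabilityMeasure (ρ n) :=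
    Measure.isProbabilityMeasure_map ((hinit n).prodMk (hlast n)).aemeasurable
  -- The conditional law of coordinate `n + 1` given the earlier ones. Running these kernels from
  -- the law of coordinate `0` recovers each `P (Finset.Iic n)` by induction.
  let κ (n : ℕ) : Kernel (Finset.Iic n → G) G := (ρ n).condKernel
  have hfst (n : ℕ) : (ρ n).fst = P (Finset.Iic n) := by
    rw [Measure.fst, Measure.map_map measurable_fst ((hinit n).prodMk (hlast n)),
      hP (Finset.Iic (n + 1)) (Finset.Iic n) (Finset.Iic_subset_Iic.2 n.le_succ)]
    rfl
  let zero : Finset.Iic 0 := ⟨0, by simp⟩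
  let μ₀ : Measure G := (P (Finset.Iic 0)).map fun x => x zero
  have hμ₀ : IsProbabilityMeasure μ₀ :=
    Measure.isProbabilityMeasure_map (measurable_pi_apply _).aemeasurable
  let ν : Measure (ℕ → G) := Kernel.trajMeasure (X := fun _ => G) μ₀ κ
  refine ⟨ν, (isProjectiveLimit_nat_iff hP ν).2 fun n => ?_⟩
  induction n with
  | zero =>
    have hz (x : Finset.Iic 0 → G) : (MeasurableEquiv.piUnique fun _ : Finset.Iic 0 => G) x
        = x zero := by
      change x default = x zero
      congr 1
    have h1 : μ₀.map (MeasurableEquiv.piUnique fun _ : Finset.Iic 0 => G).symm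
        = P (Finset.Iic 0) := by
      have : μ₀ = (P (Finset.Iic 0)).map (MeasurableEquiv.piUnique fun _ : Finset.Iic 0 => G) := by
        congr 1
      rw [this, Measure.map_map (MeasurableEquiv.measurable _) (MeasurableEquiv.measurable _),
        MeasurableEquiv.symm_comp_self, Measure.map_id]
    rw [← h1]
    simp only [ν, Kernel.trajMeasure]
    rw [Measure.map_comp _ _ (by fun_prop), Kernel.traj_map_frestrictLe, Kernel.partialTraj_self,
      Measure.id_comp]
  | succ n ih =>
    have key := Kernel.map_frestrictLe_trajMeasure_compProd_eq_map_trajMeasure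
      (X := fun _ => G) (μ₀ := μ₀) (κ := κ) (a := n)
    have h2 : (ν.map (Preorder.frestrictLe (π := fun _ => G) n)) ⊗ₘ κ n = ρ n := by
      rw [ih, ← hfst]
      exact (ρ n).disintegrate (ρ n).condKernel
    rw [h2] at key
    -- Undoes the splitting off of the last coordinate, so that `key` becomes an identity of laws on
    -- `Finset.Iic (n + 1) → G`.
    let e (y : (Finset.Iic n → G) × G) : Finset.Iic (n + 1) → G :=
      fun i => if h : i.1 ≤ n then y.1 ⟨i.1, Finset.mem_Iic.2 h⟩ else y.2
    have he : Measurable e := by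
      refine measurable_pi_lambda _ fun i => ?_
      by_cases h : i.1 ≤ n
      · simp only [e, h, dite_true]; fun_prop
      · simp only [e, h, dite_false]; fun_prop
    have := congrArg (fun m => m.map e) key
    simp only [ρ] at this
    rw [Measure.map_map he ((hinit n).prodMk (hlast n)), Measure.map_map he (by fun_prop)] at this
    have e1 : (e ∘ fun x => (init n x, last n x)) = id := by
      funext x i
      by_cases h : i.1 ≤ n
      · simp only [e, Function.comp, h, dite_true]; rfl
      · simp only [e, Function.comp, h, dite_false, last, id]
        congr 1
        have := Finset.mem_Iic.1 i.2
        exact Subtype.ext (by simp; omega)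
    have e2 : (e ∘ fun x : ℕ → G => (Preorder.frestrictLe (π := fun _ => G) n x, x (n + 1)))
        = Preorder.frestrictLe (π := fun _ => G) (n + 1) := by
      funext x i
      by_cases h : i.1 ≤ n
      · simp only [e, Function.comp, h, dite_true]; rfl
      · simp only [e, Function.comp, h, dite_false]
        have := Finset.mem_Iic.1 i.2
        have h' : i.1 = n + 1 := by omega
        simp [Preorder.frestrictLe, h']
    rw [e1, e2, Measure.map_id] at this
    exact this.symm

/-- A projective family of probability measures on powers of a standard Borel space has an
extension which is correct on the finite subsets of a given countable set of indices. -/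
theorem exists_measure_map_restrict_eq_of_countable {ι : Type*} (P : ∀ J : Finset ι, Measure (J → G))
    [∀ J, IsProbabilityMeasure (P J)] (hP : IsProjectiveMeasureFamily (α := fun _ => G) P)
    {u : Set ι} (hu : u.Countable) (hne : u.Nonempty) :
    ∃ ν : Measure (ι → G), IsProbabilityMeasure ν ∧
      ∀ I : Finset ι, (I : Set ι) ⊆ u → ν.map (Finset.restrict (π := fun _ => G) I) = P I := by
  classical
  obtain ⟨e, he⟩ := hu.exists_eq_range hne
  let r (J : Finset ℕ) (x : J.image e → G) (j : J) : G :=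
    x ⟨e j, Finset.mem_image_of_mem e j.2⟩
  have hr (J : Finset ℕ) : Measurable (r J) :=
    measurable_pi_lambda _ fun _ => measurable_pi_apply _
  let Q (J : Finset ℕ) : Measure (J → G) := (P (J.image e)).map (r J)
  have hQ (J : Finset ℕ) : IsProbabilityMeasure (Q J) :=
    Measure.isProbabilityMeasure_map (hr J).aemeasurable
  have hQP : IsProjectiveMeasureFamily (α := fun _ => G) Q := by
    intro I J hJI
    have h1 : Measurable (Finset.restrict₂ (π := fun _ => G) hJI) := Finset.measurable_restrict₂ _
    simp only [Q]
    rw [Measure.map_map h1 (hr I), hP (I.image e) (J.image e) (Finset.image_subset_image hJI),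
      Measure.map_map (hr J) (Finset.measurable_restrict₂ _)]
    rfl
  obtain ⟨ν, hν⟩ := exists_isProjectiveLimit_nat Q hQP
  have hνp : IsProbabilityMeasure ν := hν.isProbabilityMeasure
  -- The enumeration `e` may repeat, so one preimage is fixed for each index. Values of `g` outside
  -- `u` are arbitrary and never tested.
  let g (i : ι) : ℕ := Function.invFun e i
  have hg {i : ι} (hi : i ∈ u) : e (g i) = i := by
    rw [he] at hi
    exact Function.invFun_eq hi
  let f (x : ℕ → G) (i : ι) : G := x (g i)
  have hf : Measurable f := measurable_pi_lambda _ fun _ => measurable_pi_apply _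
  refine ⟨ν.map f, Measure.isProbabilityMeasure_map hf.aemeasurable, fun I hI => ?_⟩
  let J : Finset ℕ := I.image g
  have hJI : J.image e = I := by
    ext i
    simp only [J, Finset.mem_image, exists_exists_and_eq_and]
    constructor
    · rintro ⟨a, ha, rfl⟩
      rwa [hg (hI ha)]
    · exact fun hi => ⟨i, hi, hg (hI hi)⟩
  let k (x : J → G) (i : I) : G := x ⟨g i, Finset.mem_image_of_mem g i.2⟩
  have hk : Measurable k := measurable_pi_lambda _ fun _ => measurable_pi_apply _
  have h1 : ((ν.map f).map (Finset.restrict (π := fun _ => G) I)) = (Q J).map k := by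
    rw [← hν J, Measure.map_map (Finset.measurable_restrict _) hf,
      Measure.map_map hk (Finset.measurable_restrict _)]
    rfl
  have h2 : (k ∘ r J) = Finset.restrict₂ (π := fun _ => G) hJI.ge := by
    funext x i
    simp only [k, r, Function.comp, Finset.restrict₂]
    congr 1
    exact Subtype.ext (hg (hI i.2))
  rw [h1, Measure.map_map hk (hr J), h2, ← hP]

/-- **Kolmogorov extension theorem** for powers of a standard Borel space. -/
theorem exists_isProjectiveLimit {ι : Type*} (P : ∀ J : Finset ι, Measure (J → G))
    [∀ J, IsProbabilityMeasure (P J)] (hP : IsProjectiveMeasureFamily (α := fun _ => G) P) :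
    ∃ ν : Measure (ι → G), IsProjectiveLimit (α := fun _ => G) ν P := by
  rcases isEmpty_or_nonempty ι with hι | ⟨⟨i₀⟩⟩
  · obtain ⟨ν, hν⟩ : ∃ ν : Measure (ι → G), ν.map (Finset.restrict (π := fun _ => G) ∅) = P ∅ := by
      let e : ((∅ : Finset ι) → G) → ι → G := fun _ i => hι.elim i
      have he : Measurable e := measurable_pi_lambda _ fun i => hι.elim i
      refine ⟨(P ∅).map e, ?_⟩
      rw [Measure.map_map (Finset.measurable_restrict _) he]
      convert Measure.map_id
      exact Subsingleton.elim _ _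
    refine ⟨ν, fun I => ?_⟩
    obtain rfl : I = ∅ := Finset.eq_empty_of_isEmpty I
    exact hν
  let C := projectiveFamilyContent hP
  have htend : ∀ ⦃A : ℕ → Set (ι → G)⦄ (_ : ∀ n, A n ∈ measurableCylinders fun _ : ι => G),
      Antitone A → (⋂ n, A n) = ∅ → Tendsto (fun n => C (A n)) atTop (𝓝 0) := by
    intro A hA hanti hempty
    choose s S mS hS using fun n => (mem_measurableCylinders (A n)).1 (hA n)
    -- Countably many cylinders involve only countably many coordinates. On them the content agrees
    -- with a genuine measure, from which continuity at `∅` is inherited; `i₀` only keeps `u`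
    -- nonempty.
    let u : Set ι := insert i₀ (⋃ n, (s n : Set ι))
    have hu : u.Countable := (Set.countable_iUnion fun n => (s n).countable_toSet).insert _
    obtain ⟨ν, hν, hνP⟩ :=
      exists_measure_map_restrict_eq_of_countable P hP hu (Set.insert_nonempty _ _)
    have hC (n : ℕ) : C (A n) = ν (A n) := by
      have hsub : ((s n : Finset ι) : Set ι) ⊆ u :=
        (Set.subset_iUnion (fun n => ((s n : Finset ι) : Set ι)) n).trans (Set.subset_insert _ _)
      rw [hS n, projectiveFamilyContent_cylinder hP (mS n), cylinder,
        ← Measure.map_apply (Finset.measurable_restrict _) (mS n), hνP _ hsub]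
    simp_rw [hC]
    rw [← measure_empty (μ := ν), ← hempty]
    exact tendsto_measure_iInter_atTop
      (fun n => (MeasurableSet.of_mem_measurableCylinders (hA n)).nullMeasurableSet) hanti
      ⟨0, measure_ne_top _ _⟩
  have hsub : C.IsSigmaSubadditive :=
    isSigmaSubadditive_of_addContent_iUnion_eq_tsum isSetRing_measurableCylinders
      fun f hf hfU hf' => addContent_iUnion_eq_sum_of_tendsto_zero isSetRing_measurableCylinders C
        (fun _ _ => projectiveFamilyContent_ne_top hP) htend hf hfU hf'
  refine ⟨C.measure isSetSemiring_measurableCylinders generateFrom_measurableCylinders.ge hsub,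
    fun I => ?_⟩
  ext S hS
  rw [Measure.map_apply (Finset.measurable_restrict I) hS, ← cylinder,
    AddContent.measure_eq _ isSetSemiring_measurableCylinders
      generateFrom_measurableCylinders.symm hsub (cylinder_mem_measurableCylinders I S hS)]
  exact projectiveFamilyContent_cylinder hP hS

end Kolmogorov

end MeasureTheory

/-! ### Ordered products -/

/-- The ordered product `x i * x (i + 1) * ⋯ * x (i + k - 1)`. -/
def blockProd {G : Type*} [Monoid G] (x : ℕ → G) (i : ℕ) : ℕ → G
  | 0 => 1
  | k + 1 => blockProd x i k * x (i + k)

/-- Extension of a finite sequence by the unit. -/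
def extendFin {G : Type*} [One G] {n : ℕ} (x : Fin n → G) (k : ℕ) : G :=
  if h : k < n then x ⟨k, h⟩ else 1

/-- Extension of a finite family by the unit. -/
def extendFinset {G κ : Type*} [One G] [DecidableEq κ] (S : Finset κ) (x : S → G) (k : κ) : G :=
  if h : k ∈ S then x ⟨k, h⟩ else 1

section blockProd

variable {G : Type*} [Monoid G]

theorem blockProd_add (x : ℕ → G) (i k l : ℕ) :
    blockProd x i (k + l) = blockProd x i k * blockProd x (i + k) l := by
  induction l with
  | zero => simp [blockProd]
  | succ l ih => rw [← add_assoc, blockProd, ih, blockProd, mul_assoc, add_assoc]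

theorem blockProd_congr {x y : ℕ → G} {i k : ℕ} (h : ∀ j, i ≤ j → j < i + k → x j = y j) :
    blockProd x i k = blockProd y i k := by
  induction k with
  | zero => rfl
  | succ k ih =>
    rw [blockProd, blockProd, ih fun j h1 h2 => h j h1 (by omega), h (i + k) (by omega) (by omega)]

variable [MeasurableSpace G]

@[fun_prop]
theorem measurable_blockProd [MeasurableMul₂ G] (i k : ℕ) :
    Measurable fun x : ℕ → G => blockProd x i k := by
  induction k with
  | zero => exact measurable_const
  | succ k ih => exact ih.mul (measurable_pi_apply _)

@[fun_prop]
theorem measurable_extendFin {n : ℕ} : Measurable (extendFin : (Fin n → G) → ℕ → G) := by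
  refine measurable_pi_lambda _ fun k => ?_
  by_cases h : k < n
  · simp only [extendFin, h, dite_true]; fun_prop
  · simp only [extendFin, h, dite_false]; fun_prop

@[fun_prop]
theorem measurable_extendFinset {κ : Type*} [DecidableEq κ] (S : Finset κ) :
    Measurable (extendFinset S : (S → G) → κ → G) := by
  refine measurable_pi_lambda _ fun k => ?_
  by_cases h : k ∈ S
  · simp only [extendFinset, h, dite_true]; fun_prop
  · simp only [extendFinset, h, dite_false]; fun_prop

end blockProd

/-- Tuples of independent random variables along disjoint finite sets of indices are
independent. -/
theorem ProbabilityTheory.iIndepFun.finset_blocks {Ω κ ι β : Type*} [MeasurableSpace Ω]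
    [MeasurableSpace β] {P : Measure Ω} {f : κ → Ω → β} (hf : iIndepFun f P)
    (hm : ∀ k, Measurable (f k)) (B : ι → Finset κ) (hB : Pairwise fun i j => Disjoint (B i) (B j)) :
    iIndepFun (fun i ω (k : B i) => f k ω) P := by
  have := hf.isProbabilityMeasure
  have hinj : Function.Injective fun p : (i : ι) × B i => (p.2 : κ) := by
    rintro ⟨i, k, hk⟩ ⟨j, l, hl⟩ h
    obtain rfl : k = l := h
    obtain rfl : i = j := by
      by_contra hij
      exact Finset.disjoint_left.1 (hB hij) hk hl
    rfl
  have h1 := hf.precomp hinj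
  have h2 := (iIndepFun_iff_map_fun_eq_infinitePi_map fun p => hm _).1 h1
  rw [iIndepFun_iff_map_fun_eq_infinitePi_map
    fun i => measurable_pi_lambda _ fun k => hm _]
  have hprob (k : κ) : IsProbabilityMeasure (P.map (f k)) :=
    Measure.isProbabilityMeasure_map (hm k).aemeasurable
  have h3 (i : ι) : P.map (fun ω (k : B i) => f k ω)
      = Measure.infinitePi fun k : B i => P.map (f k) := by
    have h4 : iIndepFun (fun k : B i => f k) P := hf.precomp Subtype.val_injective
    exact (iIndepFun_iff_map_fun_eq_infinitePi_map fun k => hm _).1 h4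
  simp_rw [h3]
  rw [← Measure.infinitePi_map_piCurry (fun i (k : B i) => P.map (f k)), ← h2,
    Measure.map_map (by fun_prop) (measurable_pi_lambda _ fun p => hm _)]
  rfl

/-! ### Flows along a set of times -/

/-- `X s t`, `s < t`, `s, t ∈ K`, has independent increments with laws `μ (t - s)` and satisfies
the flow equation. -/
structure IsFlowOn {Ω G : Type*} [MeasurableSpace Ω] [Monoid G] [MeasurableSpace G]
    (μ : ℝ → Measure G) (P : Measure Ω) (X : ℝ → ℝ → Ω → G) (K : Set ℝ) : Prop where
  measurable : ∀ s ∈ K, ∀ t ∈ K, s < t → Measurable (X s t)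
  law : ∀ s ∈ K, ∀ t ∈ K, s < t → P.map (X s t) = μ (t - s)
  indep : ∀ (n : ℕ) (τ : Fin (n + 1) → ℝ), (∀ i, τ i ∈ K) → StrictMono τ →
    iIndepFun (fun (i : Fin n) => X (τ i.castSucc) (τ i.succ)) P
  mul : ∀ r ∈ K, ∀ s ∈ K, ∀ t ∈ K, r < s → s < t → X r t =ᵐ[P] fun ω => X r s ω * X s t ω

theorem IsStationaryFlow.isFlowOn {Ω G : Type*} [MeasurableSpace Ω] [Monoid G] [TopologicalSpace G]
    [MeasurableSpace G] {μ : ℝ → Measure G} {P : Measure Ω} {X : ℝ → ℝ → Ω → G}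
    (hX : IsStationaryFlow μ P X) (K : Set ℝ) : IsFlowOn μ P X K where
  measurable s _ t _ := hX.measurable s t
  law s _ t _ := hX.law s t
  indep n τ _ := hX.indep n τ
  mul r _ s _ t _ := hX.mul r s t

theorem Finset.exists_strictMono_range_eq (K : Finset ℝ) (hK : K.Nonempty) :
    ∃ (n : ℕ) (σ : Fin (n + 1) → ℝ), StrictMono σ ∧ Set.range σ = K := by
  obtain ⟨n, hn⟩ := Nat.exists_eq_succ_of_ne_zero hK.card_pos.ne'
  exact ⟨n, K.orderEmbOfFin hn, (K.orderEmbOfFin hn).strictMono, K.range_orderEmbOfFin hn⟩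

/-- Padding with later times lets any finite set of times sit inside one infinite sequence, so
increments can always be modelled as coordinates of a product measure on `ℕ → G`. -/
theorem Finset.exists_strictMono_subset_range (K : Finset ℝ) :
    ∃ τ : ℕ → ℝ, StrictMono τ ∧ (K : Set ℝ) ⊆ Set.range τ := by
  rcases K.eq_empty_or_nonempty with rfl | hK
  · exact ⟨fun n => n, Nat.strictMono_cast, by simp⟩
  obtain ⟨n, σ, hσ, hσK⟩ := K.exists_strictMono_range_eq hK
  refine ⟨fun i => if h : i < n + 1 then σ ⟨i, h⟩ else σ (Fin.last n) + i, ?_, ?_⟩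
  · refine strictMono_nat_of_lt_succ fun i => ?_
    by_cases h1 : i + 1 < n + 1
    · simp only [h1, dite_true, Nat.lt_of_succ_lt h1]
      exact hσ (by simp [Fin.lt_def])
    · by_cases h2 : i < n + 1
      · simp only [h1, h2, dite_true, dite_false]
        have : σ ⟨i, h2⟩ ≤ σ (Fin.last n) := hσ.monotone (Fin.le_last _)
        push_cast
        have : (0 : ℝ) ≤ i := by positivity
        linarith
      · simp only [h1, h2, dite_false]
        push_cast
        linarith
  · rw [← hσK]
    rintro _ ⟨i, rfl⟩
    exact ⟨i, by simp [Nat.lt_succ_iff.1 i.2]⟩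

namespace IsFlowOn

variable {Ω G : Type*} [MeasurableSpace Ω] [Monoid G] [MeasurableSpace G]
  {μ : ℝ → Measure G} {P : Measure Ω} {X : ℝ → ℝ → Ω → G} {K : Set ℝ}

/-- The values of a flow are ordered products of consecutive increments. -/
theorem ae_eq_blockProd (hX : IsFlowOn μ P X K) {n : ℕ} {σ : Fin (n + 1) → ℝ} (hσ : StrictMono σ)
    (hσK : ∀ i, σ i ∈ K) {i j : Fin (n + 1)} (hij : i < j) :
    X (σ i) (σ j) =ᵐ[P] fun ω =>
      blockProd (extendFin fun k : Fin n => X (σ k.castSucc) (σ k.succ) ω) i (j - i) := by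
  obtain ⟨i, hi⟩ := i
  obtain ⟨j, hj⟩ := j
  obtain ⟨k, rfl⟩ : ∃ k, j = i + k + 1 := ⟨j - i - 1, by have : i < j := hij; omega⟩
  have hsub : i + k + 1 - i = k + 1 := by omega
  simp only [hsub]
  clear hij hsub
  induction k with
  | zero =>
    have h : i < n := by omega
    refine Eventually.of_forall fun ω => ?_
    simp [blockProd, extendFin, h]
  | succ k ih =>
    have h : i + (k + 1) < n := by omega
    filter_upwards [ih (by omega), hX.mul (σ ⟨i, hi⟩) (hσK _) (σ ⟨i + k + 1, by omega⟩) (hσK _)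
      (σ ⟨i + (k + 1) + 1, hj⟩) (hσK _) (hσ (by simp [Fin.lt_def]))
      (hσ (by simp [Fin.lt_def]))] with ω h1 h2
    rw [h2, h1, blockProd.eq_2 _ _ (k + 1)]
    congr 1
    simp only [extendFin, h, dite_true]
    rfl

/-- The joint laws of a flow in terms of the laws of the increments. -/
theorem map_eq_pi_map [MeasurableMul₂ G] (hX : IsFlowOn μ P X K) {n : ℕ}
    {σ : Fin (n + 1) → ℝ} (hσ : StrictMono σ) (hσK : ∀ i, σ i ∈ K) {ι : Type*} [Countable ι]
    {a b : ι → Fin (n + 1)} (hab : ∀ i, a i < b i) :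
    P.map (fun ω i => X (σ (a i)) (σ (b i)) ω)
      = (Measure.pi fun k : Fin n => μ (σ k.succ - σ k.castSucc)).map
        fun x i => blockProd (extendFin x) (a i) (b i - a i) := by
  have hlt (k : Fin n) : σ k.castSucc < σ k.succ := hσ k.castSucc_lt_succ
  have hmeas (k : Fin n) : Measurable (X (σ k.castSucc) (σ k.succ)) :=
    hX.measurable _ (hσK _) _ (hσK _) (hlt k)
  have hpi := (hX.indep n σ hσK hσ).map_fun_eq_pi_map fun k => (hmeas k).aemeasurable
  have hlaw (k : Fin n) : P.map (X (σ k.castSucc) (σ k.succ)) = μ (σ k.succ - σ k.castSucc) :=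
    hX.law _ (hσK _) _ (hσK _) (hlt k)
  simp_rw [hlaw] at hpi
  have hF : Measurable fun (x : Fin n → G) i => blockProd (extendFin x) (a i) (b i - a i) :=
    measurable_pi_lambda _ fun i => (measurable_blockProd _ _).comp measurable_extendFin
  rw [← hpi, Measure.map_map hF (measurable_pi_lambda _ hmeas)]
  refine Measure.map_congr ?_
  filter_upwards [ae_all_iff.2 fun i => hX.ae_eq_blockProd hσ hσK (hab i)] with ω hω
  exact funext hω

/-- The joint laws of a flow are determined by the convolution semigroup. -/
theorem map_eq_map [MeasurableMul₂ G] [IsProbabilityMeasure P] {Ω' : Type*} [MeasurableSpace Ω']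
    {P' : Measure Ω'} [IsProbabilityMeasure P'] {X' : ℝ → ℝ → Ω' → G} {K' : Set ℝ}
    (hX : IsFlowOn μ P X K) (hX' : IsFlowOn μ P' X' K') {ι : Type*} [Finite ι]
    (p : ι → ℝ × ℝ) (hp : ∀ i, (p i).1 < (p i).2) (hK : ∀ i, (p i).1 ∈ K ∧ (p i).2 ∈ K)
    (hK' : ∀ i, (p i).1 ∈ K' ∧ (p i).2 ∈ K') :
    P.map (fun ω i => X (p i).1 (p i).2 ω) = P'.map (fun ω i => X' (p i).1 (p i).2 ω) := by
  classical
  have := Fintype.ofFinite ι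
  rcases isEmpty_or_nonempty ι with hι | ⟨⟨i₀⟩⟩
  · have hm : Measurable fun ω i => X (p i).1 (p i).2 ω := measurable_pi_lambda _ hι.elim
    have hm' : Measurable fun ω i => X' (p i).1 (p i).2 ω := measurable_pi_lambda _ hι.elim
    ext A hA
    rw [Measure.map_apply hm hA, Measure.map_apply hm' hA]
    rcases Set.eq_empty_or_nonempty A with rfl | hne
    · simp
    · simp [Subsingleton.eq_univ_of_nonempty hne]
  let E : Finset ℝ := Finset.univ.image (fun i => (p i).1) ∪ Finset.univ.image fun i => (p i).2
  have h1E (i : ι) : (p i).1 ∈ E := by simp [E]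
  have h2E (i : ι) : (p i).2 ∈ E := by simp [E]
  obtain ⟨n, σ, hσ, hσE⟩ := E.exists_strictMono_range_eq ⟨_, h1E i₀⟩
  have hE {L : Set ℝ} (hL : ∀ i, (p i).1 ∈ L ∧ (p i).2 ∈ L) (k : Fin (n + 1)) : σ k ∈ L := by
    have : σ k ∈ (E : Set ℝ) := hσE ▸ Set.mem_range_self k
    simp only [E, Finset.coe_union, Finset.coe_image, Finset.coe_univ, Set.image_univ,
      Set.mem_union, Set.mem_range] at this
    rcases this with ⟨i, hi⟩ | ⟨i, hi⟩
    · exact hi ▸ (hL i).1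
    · exact hi ▸ (hL i).2
  have hmem (s : ℝ) (hs : s ∈ E) : ∃ k, σ k = s := by
    have : s ∈ Set.range σ := hσE ▸ hs
    exact this
  choose a ha using fun i => hmem _ (h1E i)
  choose b hb using fun i => hmem _ (h2E i)
  have hab (i : ι) : a i < b i := hσ.lt_iff_lt.1 (by rw [ha, hb]; exact hp i)
  simp_rw [← ha, ← hb]
  rw [hX.map_eq_pi_map hσ (hE hK) hab, hX'.map_eq_pi_map hσ (hE hK') hab]

/-- The past and the future of a flow are independent: finitely many values. -/
theorem indepFun_of_le [MeasurableMul₂ G] (hX : IsFlowOn μ P X Set.univ)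
    {ι κ : Type*} [Finite ι] [Finite κ] (p : ι → ℝ × ℝ) (q : κ → ℝ × ℝ) (s : ℝ)
    (hp : ∀ i, (p i).1 < (p i).2) (hq : ∀ i, (q i).1 < (q i).2)
    (hps : ∀ i, (p i).2 ≤ s) (hqs : ∀ i, s ≤ (q i).1) :
    IndepFun (fun ω i => X (p i).1 (p i).2 ω) (fun ω i => X (q i).1 (q i).2 ω) P := by
  classical
  have := Fintype.ofFinite ι
  have := Fintype.ofFinite κ
  -- With `s` itself a partition point no consecutive increment straddles it, so the two families
  -- are products over the disjoint index sets `S` and `T` below.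
  let E : Finset ℝ := insert s ((Finset.univ.image (fun i => (p i).1) ∪
    Finset.univ.image fun i => (p i).2) ∪ (Finset.univ.image (fun i => (q i).1) ∪
    Finset.univ.image fun i => (q i).2))
  obtain ⟨n, σ, hσ, hσE⟩ := E.exists_strictMono_range_eq (Finset.insert_nonempty _ _)
  have hmem (s : ℝ) (hs : s ∈ E) : ∃ k, σ k = s := by
    have : s ∈ Set.range σ := hσE ▸ hs
    exact this
  obtain ⟨m, rfl⟩ := hmem s (by simp [E])
  choose a ha using fun i => hmem (p i).1 (by simp [E])
  choose b hb using fun i => hmem (p i).2 (by simp [E])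
  choose c hc using fun i => hmem (q i).1 (by simp [E])
  choose d hd using fun i => hmem (q i).2 (by simp [E])
  simp_rw [← ha, ← hb, hσ.lt_iff_lt] at hp
  simp_rw [← hc, ← hd, hσ.lt_iff_lt] at hq
  simp_rw [← hb, hσ.le_iff_le] at hps
  simp_rw [← hc, hσ.le_iff_le] at hqs
  simp_rw [← ha, ← hb, ← hc, ← hd]
  have hlt (k : Fin n) : σ k.castSucc < σ k.succ := hσ k.castSucc_lt_succ
  have hmeas (k : Fin n) : Measurable (X (σ k.castSucc) (σ k.succ)) :=
    hX.measurable _ trivial _ trivial (hlt k)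
  let S : Finset (Fin n) := Finset.univ.filter fun k => k.val < m.val
  let T : Finset (Fin n) := Finset.univ.filter fun k => m.val ≤ k.val
  have hST : Disjoint S T := by
    rw [Finset.disjoint_left]
    intro k hk hk'
    simp only [S, T, Finset.mem_filter] at hk hk'
    omega
  have hind := (hX.indep n σ (fun _ => trivial) hσ).indepFun_finset S T hST hmeas
  have hF (U : Finset (Fin n)) (i j : Fin (n + 1)) : Measurable
      fun x : U → G => blockProd (extendFin (extendFinset U x)) i (j - i) :=
    (measurable_blockProd _ _).comp (measurable_extendFin.comp (measurable_extendFinset _))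
  have hX' {i j : Fin (n + 1)} (hij : i < j) (U : Finset (Fin n))
      (hU : ∀ k : Fin n, i.val ≤ k.val → k.val < j.val → k ∈ U) :
      (fun ω => blockProd (extendFin (extendFinset U
        fun k => X (σ k.1.castSucc) (σ k.1.succ) ω)) i (j - i)) =ᵐ[P] X (σ i) (σ j) := by
    filter_upwards [hX.ae_eq_blockProd hσ (fun _ => trivial) hij] with ω hω
    rw [hω]
    refine blockProd_congr fun k h1 h2 => ?_
    have h3 : k < n := by have := j.2; omega
    simp only [extendFin, h3, dite_true, extendFinset]
    rw [dif_pos (hU ⟨k, h3⟩ h1 (by simp only; omega))]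
  refine (hind.comp (measurable_pi_lambda _ fun i => hF S (a i) (b i))
    (measurable_pi_lambda _ fun i => hF T (c i) (d i))).congr ?_ ?_
  · filter_upwards [ae_all_iff.2 fun i => hX' (hp i) S fun k _ h2 => by
      simp only [S, Finset.mem_filter, Finset.mem_univ, true_and]
      exact h2.trans_le (hps i)] with ω hω
    exact funext hω
  · filter_upwards [ae_all_iff.2 fun i => hX' (hq i) T fun k h1 _ => by
      simp only [T, Finset.mem_filter, Finset.mem_univ, true_and]
      exact le_trans (hqs i) h1] with ω hω
    exact funext hω

end IsFlowOn

/-! ### Construction of flows -/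

/-- The flow on the times `τ 0 < τ 1 < ⋯` with given increments. -/
noncomputable def sequenceFlow {G : Type*} [Monoid G] (τ : ℕ → ℝ) (s t : ℝ) (x : ℕ → G) : G :=
  blockProd x (Function.invFun τ s) (Function.invFun τ t - Function.invFun τ s)

theorem measurable_sequenceFlow {G : Type*} [Monoid G] [MeasurableSpace G] [MeasurableMul₂ G]
    (τ : ℕ → ℝ) (s t : ℝ) : Measurable (sequenceFlow (G := G) τ s t) :=
  measurable_blockProd _ _

/-- The joint law of the increments of a flow on the times `τ 0 < τ 1 < ⋯`. -/
noncomputable def incrementMeasure {G : Type*} [MeasurableSpace G] (μ : ℝ → Measure G)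
    (τ : ℕ → ℝ) : Measure (ℕ → G) :=
  Measure.infinitePi fun i => μ (τ (i + 1) - τ i)

section Construction

variable {G : Type*} [Monoid G] [TopologicalSpace G] [MeasurableSpace G]

variable {μ : ℝ → Measure G}

theorem IsWeaklyContinuousConvolutionSemigroup.isProbabilityMeasure_increment
    (hμ : IsWeaklyContinuousConvolutionSemigroup μ) {τ : ℕ → ℝ}
    (hτ : StrictMono τ) (i : ℕ) : IsProbabilityMeasure (μ (τ (i + 1) - τ i)) :=
  hμ.isProbabilityMeasure _ (sub_pos.2 (hτ i.lt_succ_self))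

/-- Laws over several gaps follow from the convolution property by induction on the number of gaps,
independence from the disjointness of the blocks of indices, and the flow equation from
associativity. -/
theorem isFlowOn_sequenceFlow [MeasurableMul₂ G]
    (hμ : IsWeaklyContinuousConvolutionSemigroup μ) {τ : ℕ → ℝ} (hτ : StrictMono τ) :
    IsFlowOn μ (incrementMeasure μ τ) (sequenceFlow τ) (Set.range τ) := by
  have hp := hμ.isProbabilityMeasure_increment hτ
  have hpr : IsProbabilityMeasure (incrementMeasure μ τ) := by
    unfold incrementMeasure; infer_instance
  have hinv (i : ℕ) : Function.invFun τ (τ i) = i := Function.leftInverse_invFun hτ.injective i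
  have hind : iIndepFun (fun (i : ℕ) (x : ℕ → G) => x i) (incrementMeasure μ τ) :=
    iIndepFun_infinitePi (X := fun _ x => x) fun _ => measurable_id
  have hm (i : ℕ) : Measurable fun x : ℕ → G => x i := measurable_pi_apply i
  -- Exhibits a block product as a function of the coordinates in `B` alone, the form required by
  -- the independence lemmas.
  have hext (B : Finset ℕ) {i k : ℕ} (h : ∀ j, i ≤ j → j < i + k → j ∈ B) (x : ℕ → G) :
      blockProd (extendFinset B fun j => x j) i k = blockProd x i k := by
    refine blockProd_congr fun j h1 h2 => ?_
    simp [extendFinset, h j h1 h2]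
  refine ⟨?_, ?_, ?_, ?_⟩
  · rintro _ ⟨i, rfl⟩ _ ⟨j, rfl⟩ -
    exact measurable_blockProd _ _
  · rintro _ ⟨i, rfl⟩ _ ⟨j, rfl⟩ hij
    have hij := hτ.lt_iff_lt.1 hij
    obtain ⟨k, rfl⟩ := Nat.exists_eq_add_of_lt hij
    have h1 : sequenceFlow (G := G) τ (τ i) (τ (i + k + 1)) = fun x => blockProd x i (k + 1) := by
      funext x
      simp only [sequenceFlow, hinv]
      congr 1
      omega
    rw [h1]
    clear hij h1
    induction k with
    | zero =>
      simp only [blockProd, one_mul]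
      exact Measure.infinitePi_map_eval (fun i => μ (τ (i + 1) - τ i)) i
    | succ k ih =>
      have h2 : IndepFun (fun x : ℕ → G => blockProd x i (k + 1)) (fun x => x (i + (k + 1)))
          (incrementMeasure μ τ) := by
        have h3 := hind.indepFun_finset (Finset.Ico i (i + (k + 1))) {i + (k + 1)} (by simp) hm
        have h4 := h3.comp (φ := fun x : Finset.Ico i (i + (k + 1)) → G =>
          blockProd (extendFinset (Finset.Ico i (i + (k + 1))) x) i (k + 1))
          (ψ := fun x => x ⟨i + (k + 1), by simp⟩)
          ((measurable_blockProd i (k + 1)).comp (measurable_extendFinset _))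
          (measurable_pi_apply (X := fun _ => G) _)
        refine h4.congr (Eventually.of_forall fun x => ?_) (Eventually.of_forall fun x => rfl)
        exact hext _ (fun j h h' => by simp [h]; omega) x
      have h5 := h2.map_mul_eq_map_mconv_map (measurable_blockProd _ _) (hm _)
      have h6 : (incrementMeasure μ τ).map (fun x : ℕ → G => x (i + (k + 1)))
          = μ (τ (i + (k + 1) + 1) - τ (i + (k + 1))) :=
        Measure.infinitePi_map_eval (fun i => μ (τ (i + 1) - τ i)) _
      rw [ih (hτ (by omega)), h6, hμ.conv _ _ (sub_pos.2 (hτ (by omega))) (sub_pos.2 (hτ (by omega)))] at h5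
      have h7 : τ (i + k + 1) - τ i + (τ (i + (k + 1) + 1) - τ (i + (k + 1)))
          = τ (i + (k + 1) + 1) - τ i := by rw [← add_assoc]; ring
      rw [h7] at h5
      exact h5
  · intro n σ hσ hσm
    choose a ha using hσ
    obtain rfl : σ = fun i => τ (a i) := funext fun i => (ha i).symm
    have ham : StrictMono a := fun i j h => hτ.lt_iff_lt.1 (hσm h)
    let B (i : Fin n) : Finset ℕ := Finset.Ico (a i.castSucc) (a i.succ)
    have hB : Pairwise fun i j => Disjoint (B i) (B j) := by
      have : ∀ i j, i < j → Disjoint (B i) (B j) := by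
        intro i j h
        rw [Finset.disjoint_left]
        intro k hk hk'
        simp only [B, Finset.mem_Ico] at hk hk'
        have h3 : a i.succ ≤ a j.castSucc := ham.monotone (by
          rw [Fin.le_def]; simp; exact h)
        omega
      intro i j h
      rcases lt_or_gt_of_ne h with h | h
      · exact this i j h
      · exact (this j i h).symm
    have h1 := (hind.finset_blocks hm B hB).comp
      (fun i x => blockProd (extendFinset (B i) x) (a i.castSucc) (a i.succ - a i.castSucc))
      fun i => (measurable_blockProd _ _).comp (measurable_extendFinset _)
    convert h1 using 2 with i
    funext x
    simp only [sequenceFlow, hinv, Function.comp]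
    exact (hext _ (fun j h h' => by simp only [B, Finset.mem_Ico]; omega) x).symm
  · rintro _ ⟨i, rfl⟩ _ ⟨j, rfl⟩ _ ⟨k, rfl⟩ hij hjk
    have hij := hτ.lt_iff_lt.1 hij
    have hjk := hτ.lt_iff_lt.1 hjk
    refine Eventually.of_forall fun x => ?_
    simp only [sequenceFlow, hinv]
    have h1 : k - i = (j - i) + (k - j) := by omega
    rw [h1, blockProd_add]
    congr 2
    omega

/-- Existence of a flow, without continuity properties. -/
theorem exists_isFlowOn_univ [StandardBorelSpace G] [MeasurableMul₂ G]
    (hμ : IsWeaklyContinuousConvolutionSemigroup μ) :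
    ∃ ν : Measure ({p : ℝ × ℝ // p.1 < p.2} → G), IsProbabilityMeasure ν ∧
      IsFlowOn μ ν (fun s t x => if h : s < t then x ⟨(s, t), h⟩ else 1) Set.univ := by
  classical
  -- Each finite set of intervals gets its own sequence of times. Different choices give the same
  -- laws by `IsFlowOn.map_eq_map`, which is what projectivity amounts to.
  choose τ hτ using fun I : Finset {p : ℝ × ℝ // p.1 < p.2} =>
    (I.image (fun p => p.1.1) ∪ I.image fun p => p.1.2).exists_strictMono_subset_range
  have hτ1 (I : Finset {p : ℝ × ℝ // p.1 < p.2}) (p : I) :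
      p.1.1.1 ∈ Set.range (τ I) ∧ p.1.1.2 ∈ Set.range (τ I) := by
    refine ⟨(hτ I).2 ?_, (hτ I).2 ?_⟩
    · exact Finset.mem_union_left _ (Finset.mem_image_of_mem (fun p => p.1.1) p.2)
    · exact Finset.mem_union_right _ (Finset.mem_image_of_mem (fun p => p.1.2) p.2)
  have hinc {τ : ℕ → ℝ} (hτ : StrictMono τ) : IsProbabilityMeasure (incrementMeasure μ τ) := by
    have := hμ.isProbabilityMeasure_increment hτ
    unfold incrementMeasure; infer_instance
  have hincI (I : Finset {p : ℝ × ℝ // p.1 < p.2}) := hinc (hτ I).1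
  have hmI (I : Finset {p : ℝ × ℝ // p.1 < p.2}) :
      Measurable fun x (p : I) => sequenceFlow (G := G) (τ I) p.1.1.1 p.1.1.2 x :=
    measurable_pi_lambda _ fun p => measurable_sequenceFlow _ _ _
  let Q (I : Finset {p : ℝ × ℝ // p.1 < p.2}) : Measure (I → G) :=
    (incrementMeasure μ (τ I)).map fun x p => sequenceFlow (τ I) p.1.1.1 p.1.1.2 x
  have hQ (I : Finset {p : ℝ × ℝ // p.1 < p.2}) : IsProbabilityMeasure (Q I) :=
    Measure.isProbabilityMeasure_map (hmI I).aemeasurable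
  have hQP : IsProjectiveMeasureFamily (α := fun _ => G) Q := by
    intro I J hJI
    have hr : Measurable (Finset.restrict₂ (π := fun _ => G) hJI) := Finset.measurable_restrict₂ _
    simp only [Q]
    rw [Measure.map_map hr (hmI I)]
    exact (isFlowOn_sequenceFlow hμ (hτ J).1).map_eq_map (isFlowOn_sequenceFlow hμ (hτ I).1)
      (fun p : J => p.1.1) (fun p => p.1.2) (hτ1 J) fun p => hτ1 I ⟨p.1, hJI p.2⟩
  obtain ⟨ν, hν⟩ := exists_isProjectiveLimit Q hQP
  have hνp : IsProbabilityMeasure ν := hν.isProbabilityMeasure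
  -- Any sequence containing the endpoints computes joint laws under `ν`, so each flow property can
  -- be transferred from a `sequenceFlow` chosen to suit it.
  have hlaw {ι : Type} [Fintype ι] (p : ι → {p : ℝ × ℝ // p.1 < p.2}) {σ : ℕ → ℝ}
      (hσ : StrictMono σ) (hp : ∀ i, (p i).1.1 ∈ Set.range σ ∧ (p i).1.2 ∈ Set.range σ) :
      ν.map (fun x i => x (p i)) =
        (incrementMeasure μ σ).map fun x i => sequenceFlow σ (p i).1.1 (p i).1.2 x := by
    let I : Finset {p : ℝ × ℝ // p.1 < p.2} := Finset.univ.image p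
    have hpI (i : ι) : p i ∈ I := Finset.mem_image_of_mem p (Finset.mem_univ i)
    have := hinc hσ
    have hm : Measurable fun (y : I → G) i => y ⟨p i, hpI i⟩ :=
      measurable_pi_lambda _ fun i => measurable_pi_apply _
    have h1 : ν.map (fun x i => x (p i)) = (Q I).map fun y i => y ⟨p i, hpI i⟩ := by
      rw [← hν I, Measure.map_map hm (Finset.measurable_restrict _)]
      rfl
    rw [h1, Measure.map_map hm (hmI I)]
    exact (isFlowOn_sequenceFlow hμ (hτ I).1).map_eq_map (isFlowOn_sequenceFlow hμ hσ)
      (fun i => (p i).1) (fun i => (p i).2) (fun i => hτ1 I ⟨p i, hpI i⟩) hp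
  refine ⟨ν, hνp, ?_, ?_, ?_, ?_⟩
  · intro s _ t _ h
    simp only [h, dite_true]
    exact measurable_pi_apply _
  · intro s _ t _ h
    simp only [h, dite_true]
    obtain ⟨σ, hσ, hst⟩ := ({s, t} : Finset ℝ).exists_strictMono_subset_range
    have hs : s ∈ Set.range σ := hst (by simp)
    have ht : t ∈ Set.range σ := hst (by simp)
    have h1 := congrArg (Measure.map fun y : Unit → G => y ())
      (hlaw (fun _ : Unit => ⟨(s, t), h⟩) hσ fun _ => ⟨hs, ht⟩)
    rw [Measure.map_map (measurable_pi_apply _) (by fun_prop), Measure.map_map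
      (measurable_pi_apply _) (measurable_pi_lambda _ fun _ => measurable_sequenceFlow _ _ _)] at h1
    exact h1.trans ((isFlowOn_sequenceFlow hμ hσ).law s hs t ht h)
  · intro n ρ _ hρ
    have hlt (i : Fin n) : ρ i.castSucc < ρ i.succ := hρ i.castSucc_lt_succ
    simp only [hlt, dite_true]
    obtain ⟨σ, hσ, hρσ⟩ := (Finset.univ.image ρ).exists_strictMono_subset_range
    have hmem (i : Fin (n + 1)) : ρ i ∈ Set.range σ := hρσ (by simp)
    have := hinc hσ
    have hflow := isFlowOn_sequenceFlow hμ hσ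
    have hms (i : Fin n) : Measurable (sequenceFlow (G := G) σ (ρ i.castSucc) (ρ i.succ)) :=
      measurable_sequenceFlow _ _ _
    rw [iIndepFun_iff_map_fun_eq_pi_map fun i => (measurable_pi_apply _).aemeasurable]
    have h1 := hlaw (fun i : Fin n => ⟨(ρ i.castSucc, ρ i.succ), hlt i⟩) hσ
      fun i => ⟨hmem _, hmem _⟩
    have h2 (i : Fin n) : ν.map (fun x => x ⟨(ρ i.castSucc, ρ i.succ), hlt i⟩)
        = (incrementMeasure μ σ).map (sequenceFlow σ (ρ i.castSucc) (ρ i.succ)) := by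
      have h3 := congrArg (Measure.map fun y : Fin n → G => y i) h1
      rw [Measure.map_map (measurable_pi_apply _) (by fun_prop), Measure.map_map
        (measurable_pi_apply _) (measurable_pi_lambda _ hms)] at h3
      exact h3
    rw [h1]
    simp_rw [h2]
    exact (hflow.indep n ρ hmem hρ).map_fun_eq_pi_map fun i => (hms i).aemeasurable
  · intro r _ s _ t _ hrs hst
    simp only [hrs, hst, hrs.trans hst, dite_true]
    obtain ⟨σ, hσ, hsub⟩ := ({r, s, t} : Finset ℝ).exists_strictMono_subset_range
    have hr : r ∈ Set.range σ := hsub (by simp)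
    have hs : s ∈ Set.range σ := hsub (by simp)
    have ht : t ∈ Set.range σ := hsub (by simp)
    let p : Fin 3 → {p : ℝ × ℝ // p.1 < p.2} :=
      ![⟨(r, t), hrs.trans hst⟩, ⟨(r, s), hrs⟩, ⟨(s, t), hst⟩]
    have h1 := hlaw p hσ (by
      intro i
      fin_cases i
      · exact ⟨hr, ht⟩
      · exact ⟨hr, hs⟩
      · exact ⟨hs, ht⟩)
    have hA : MeasurableSet {y : Fin 3 → G | y 0 = y 1 * y 2} :=
      measurableSet_eq_fun (by fun_prop) (by fun_prop)
    have h2 : ∀ᵐ y ∂(ν.map fun x i => x (p i)), y 0 = y 1 * y 2 := by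
      rw [h1, ae_map_iff
        (measurable_pi_lambda _ fun i => measurable_sequenceFlow _ _ _).aemeasurable hA]
      exact (isFlowOn_sequenceFlow hμ hσ).mul r hr s hs t ht hrs hst
    have hmp : Measurable fun (x : {p : ℝ × ℝ // p.1 < p.2} → G) (i : Fin 3) => x (p i) :=
      measurable_pi_lambda _ fun i => measurable_pi_apply _
    rwa [ae_map_iff hmp.aemeasurable hA] at h2

end Construction

/-! ### Topo-semigroups -/

/-- The range is a measurable subset, hence standard Borel; a Polish topology on it pulls back along
the equivalence with the range. -/
theorem MeasurableEmbedding.standardBorelSpace {α β : Type*} [MeasurableSpace α]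
    [MeasurableSpace β] [StandardBorelSpace β] {f : α → β} (hf : MeasurableEmbedding f) :
    StandardBorelSpace α := by
  have := hf.measurableSet_range.standardBorel
  let := upgradeStandardBorel (Set.range f)
  let e := hf.equivRange
  let τ : TopologicalSpace α := TopologicalSpace.induced e inferInstance
  have he : IsInducing e := ⟨rfl⟩
  have : BorelSpace α := e.measurableEmbedding.borelSpace he
  have hc : IsClosedEmbedding e :=
    ⟨⟨he, e.injective⟩, by rw [e.surjective.range_eq]; exact isClosed_univ⟩
  have : PolishSpace α := hc.polishSpace
  exact standardBorel_of_polish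

namespace IsTopoSemigroup

variable {G : Type*} [Monoid G] [t : TopologicalSpace G] [MeasurableSpace G] [BorelSpace G]

theorem metrizableSpace (hG : IsTopoSemigroup G) : TopologicalSpace.MetrizableSpace G := by
  obtain ⟨m, hm, -⟩ := hG.borel_in_completion
  subst hm
  infer_instance

theorem secondCountableTopology (hG : IsTopoSemigroup G) : SecondCountableTopology G := by
  have := hG.metrizableSpace
  have := hG.separable
  let := TopologicalSpace.metrizableSpaceMetric G
  exact UniformSpace.secondCountable_of_separable G

theorem measurableMul₂ (hG : IsTopoSemigroup G) : MeasurableMul₂ G := ⟨hG.measurable_mul⟩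

/-- The completion is Polish, and a topological embedding with Borel range is a measurable
embedding. -/
theorem standardBorelSpace (hG : IsTopoSemigroup G) : StandardBorelSpace G := by
  have hsep := hG.separable
  obtain ⟨m, hm, hb⟩ := hG.borel_in_completion
  subst hm
  let C := UniformSpace.Completion G
  have : TopologicalSpace.SeparableSpace C := UniformSpace.Completion.separableSpace_completion
  have : SecondCountableTopology C := UniformSpace.secondCountable_of_separable C
  have : PolishSpace C := inferInstance
  borelize C
  have he : IsEmbedding ((↑) : G → C) := UniformSpace.Completion.isUniformEmbedding_coe G |>.isEmbedding
  exact (he.measurableEmbedding hb).standardBorelSpace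

end IsTopoSemigroup

/-! ### Convergence in probability -/

section TendstoInProbability

variable {Ω G : Type*} [MeasurableSpace Ω] {P : Measure Ω} [TopologicalSpace G]
  {Y : ℕ → Ω → G} {Z : Ω → G}

theorem TendstoInProbability.exists_seq_tendsto_ae [TopologicalSpace.MetrizableSpace G]
    (h : TendstoInProbability P Y Z) :
    ∃ ns : ℕ → ℕ, StrictMono ns ∧ ∀ᵐ ω ∂P, Tendsto (fun i => Y (ns i) ω) atTop (𝓝 (Z ω)) := by
  let := TopologicalSpace.metrizableSpaceMetric G
  exact (tendstoInMeasure_iff_dist.2 (h (TopologicalSpace.metrizableSpaceMetric G) rfl)).exists_seq_tendsto_ae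

/-- The subsequence criterion mentions no metric, so limit properties of the multiplication can be
applied pointwise. -/
theorem tendstoInProbability_of_exists_seq_tendsto_ae [IsFiniteMeasure P] [MeasurableSpace G]
    [BorelSpace G] [SecondCountableTopology G] (hY : ∀ n, AEMeasurable (Y n) P)
    (h : ∀ ns : ℕ → ℕ, StrictMono ns → ∃ ns' : ℕ → ℕ, StrictMono ns' ∧
      ∀ᵐ ω ∂P, Tendsto (fun i => Y (ns (ns' i)) ω) atTop (𝓝 (Z ω))) :
    TendstoInProbability P Y Z := by
  intro m hm
  subst hm
  exact tendstoInMeasure_iff_dist.1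
    ((exists_seq_tendstoInMeasure_atTop_iff fun n => (hY n).aestronglyMeasurable).2 h)

theorem TendstoInProbability.comp (h : TendstoInProbability P Y Z) {ns : ℕ → ℕ}
    (hns : Tendsto ns atTop atTop) : TendstoInProbability P (fun n => Y (ns n)) Z :=
  fun m hm ε hε => (h m hm ε hε).comp hns

end TendstoInProbability

/-! ### Continuity of flows -/

theorem IsWeaklyContinuousConvolutionSemigroup.tendsto_compl {G : Type*} [Monoid G]
    [TopologicalSpace G] [MeasurableSpace G] {μ : ℝ → Measure G}
    (hμ : IsWeaklyContinuousConvolutionSemigroup μ) {U : Set G} (hU : U ∈ 𝓝 1)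
    (hUm : MeasurableSet U) : Tendsto (fun t => μ t Uᶜ) (𝓝[>] 0) (𝓝 0) := by
  have h1 : Tendsto (fun t => 1 - μ t U) (𝓝[>] 0) (𝓝 (1 - 1)) :=
    ENNReal.Tendsto.sub tendsto_const_nhds (hμ.weak_continuity U hU) (by simp)
  rw [tsub_self] at h1
  refine h1.congr' ?_
  filter_upwards [self_mem_nhdsWithin] with t ht
  have := hμ.isProbabilityMeasure t ht
  rw [prob_compl_eq_one_sub hUm]

namespace IsFlowOn

variable {Ω G : Type*} [MeasurableSpace Ω] [Monoid G] [TopologicalSpace G] [MeasurableSpace G]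
  [BorelSpace G] {μ : ℝ → Measure G} {P : Measure Ω} {X : ℝ → ℝ → Ω → G}

/-- Increments over short intervals converge to the unit in probability. -/
theorem tendstoInProbability_one [SecondCountableTopology G]
    (hμ : IsWeaklyContinuousConvolutionSemigroup μ) (hX : IsFlowOn μ P X Set.univ)
    {a b : ℕ → ℝ} (hab : ∀ n, a n ≤ b n) (h : Tendsto (fun n => b n - a n) atTop (𝓝 0)) :
    TendstoInProbability P (fun n ω => if a n < b n then X (a n) (b n) ω else 1)
      fun _ => 1 := by
  intro m hm ε hε
  subst hm
  have hU : MeasurableSet (Metric.ball (1 : G) ε) := Metric.isOpen_ball.measurableSet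
  have h1 := hμ.tendsto_compl (Metric.ball_mem_nhds (1 : G) hε) hU
  rw [ENNReal.tendsto_nhds_zero] at h1 ⊢
  intro η hη
  have h2 := h1 η hη
  rw [eventually_nhdsWithin_iff] at h2
  filter_upwards [h.eventually h2] with n hn
  -- Degenerate intervals carry the value `1`, so an endpoint sequence may reach its limit.
  rcases (hab n).lt_or_eq with hlt | heq
  · have h3 : {ω | ε ≤ dist (if a n < b n then X (a n) (b n) ω else 1) 1}
        = X (a n) (b n) ⁻¹' (Metric.ball 1 ε)ᶜ := by
      ext ω
      simp [hlt]
    rw [h3, ← Measure.map_apply (hX.measurable _ trivial _ trivial hlt) hU.compl,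
      hX.law _ trivial _ trivial hlt]
    exact hn (sub_pos.2 hlt)
  · have h3 : {ω | ε ≤ dist (if a n < b n then X (a n) (b n) ω else 1) 1} = ∅ := by
      ext ω
      simp [heq, hε]
    rw [h3]
    simp

/-- A flow is continuous in probability along intervals shrinking to a given interval. -/
theorem tendstoInProbability [IsProbabilityMeasure P] (hG : IsTopoSemigroup G)
    (hμ : IsWeaklyContinuousConvolutionSemigroup μ) (hX : IsFlowOn μ P X Set.univ)
    {s t : ℝ} {s' t' : ℕ → ℝ} (hst : s < t) (hs : ∀ n, s' n ≤ s) (ht : ∀ n, t ≤ t' n)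
    (hs' : Tendsto s' atTop (𝓝 s)) (ht' : Tendsto t' atTop (𝓝 t)) :
    TendstoInProbability P (fun n => X (s' n) (t' n)) (X s t) := by
  have := hG.metrizableSpace
  have := hG.secondCountableTopology
  have hlt (n : ℕ) : s' n < t' n := (hs n).trans_lt (hst.trans_le (ht n))
  have hU := hX.tendstoInProbability_one hμ hs (by
    simpa using (tendsto_const_nhds (x := s)).sub hs')
  have hV := hX.tendstoInProbability_one hμ ht (by
    simpa using ht'.sub (tendsto_const_nhds (x := t)))
  -- Precisely the shape `x n * y * z n` of the topo-semigroup axiom, with `y = X s t`.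
  have hprod (n : ℕ) : X (s' n) (t' n) =ᵐ[P] fun ω =>
      (if s' n < s then X (s' n) s ω else 1) * X s t ω * (if t < t' n then X t (t' n) ω else 1) := by
    have h1 : X (s' n) t =ᵐ[P] fun ω => (if s' n < s then X (s' n) s ω else 1) * X s t ω := by
      rcases (hs n).lt_or_eq with h | h
      · simp only [h, if_true]
        exact hX.mul _ trivial _ trivial _ trivial h hst
      · simp [h]
    rcases (ht n).lt_or_eq with h | h
    · filter_upwards [h1, hX.mul _ trivial _ trivial _ trivial ((hs n).trans_lt hst) h] with ω h2 h3
      rw [h3, h2, if_pos h]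
    · filter_upwards [h1] with ω h2
      rw [← h, h2]
      simp
  refine tendstoInProbability_of_exists_seq_tendsto_ae
    (fun n => (hX.measurable _ trivial _ trivial (hlt n)).aemeasurable) fun ns hns => ?_
  -- Two successive extractions: the first makes the left factors converge almost surely, the second
  -- also the right ones.
  obtain ⟨a, ha, hUa⟩ := (hU.comp hns.tendsto_atTop).exists_seq_tendsto_ae
  obtain ⟨b, hb, hVb⟩ := (hV.comp (hns.comp ha).tendsto_atTop).exists_seq_tendsto_ae
  refine ⟨a ∘ b, ha.comp hb, ?_⟩
  filter_upwards [hUa, hVb, ae_all_iff.2 hprod] with ω h1 h2 h3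
  have h4 := hG.tendsto_mul _ _ (X s t ω) (h1.comp hb.tendsto_atTop) h2
  simp_rw [h3]
  exact h4

theorem isStationaryFlow [IsProbabilityMeasure P] (hG : IsTopoSemigroup G)
    (hμ : IsWeaklyContinuousConvolutionSemigroup μ) (hX : IsFlowOn μ P X Set.univ) :
    IsStationaryFlow μ P X where
  measurable s t h := hX.measurable s trivial t trivial h
  law s t h := hX.law s trivial t trivial h
  indep n τ h := hX.indep n τ (fun _ => trivial) h
  mul r s t h h' := hX.mul r trivial s trivial t trivial h h'
  continuity _ _ _ _ hst hs hs' ht ht' := hX.tendstoInProbability hG hμ hst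
    (fun n => hs.ge_of_tendsto hs' n) (fun n => ht.le_of_tendsto ht' n) hs' ht'

end IsFlowOn

/-! ### Sub-σ-fields and negligible events -/

section Negligible

variable {Ω : Type*} {m : MeasurableSpace Ω} [mΩ : MeasurableSpace Ω] {P : Measure Ω}

theorem negligibleSigma_le : negligibleSigma P ≤ mΩ :=
  MeasurableSpace.generateFrom_le fun _ h => h.1

theorem measurableSet_negligibleSigma {N : Set Ω} (hN : MeasurableSet N) (h0 : P N = 0) :
    MeasurableSet[negligibleSigma P] N :=
  MeasurableSpace.measurableSet_generateFrom ⟨hN, h0⟩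

/-- The sets almost everywhere equal to an `m`-measurable set form a σ-field containing `m` and the
negligible events. -/
theorem exists_ae_eq_of_measurableSet_sup_negligibleSigma {A : Set Ω}
    (hA : MeasurableSet[m ⊔ negligibleSigma P] A) :
    ∃ B, MeasurableSet[m] B ∧ A =ᵐ[P] B := by
  have hU (A : ℕ → Set Ω) (hA : ∀ i, ∃ B, MeasurableSet[m] B ∧ A i =ᵐ[P] B) :
      ∃ B, MeasurableSet[m] B ∧ (⋃ i, A i : Set Ω) =ᵐ[P] B := by
    choose B hB hAB using hA
    exact ⟨⋃ i, B i, MeasurableSet.iUnion hB, Filter.EventuallyEq.countable_iUnion hAB⟩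
  have hC (A : Set Ω) (hA : ∃ B, MeasurableSet[m] B ∧ A =ᵐ[P] B) :
      ∃ B, MeasurableSet[m] B ∧ (Aᶜ : Set Ω) =ᵐ[P] B := by
    obtain ⟨B, hB, hAB⟩ := hA
    exact ⟨Bᶜ, hB.compl, hAB.compl⟩
  let m' : MeasurableSpace Ω :=
    { MeasurableSet' := fun A => ∃ B, MeasurableSet[m] B ∧ A =ᵐ[P] B
      measurableSet_empty := ⟨∅, @MeasurableSet.empty _ m, EventuallyEq.rfl⟩
      measurableSet_compl := hC
      measurableSet_iUnion := hU }
  have h1 : m ⊔ @negligibleSigma Ω mΩ P ≤ m' := by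
    refine sup_le ?_ (MeasurableSpace.generateFrom_le fun N hN => ?_)
    · intro B hB
      exact ⟨B, hB, EventuallyEq.rfl⟩
    exact ⟨∅, @MeasurableSet.empty _ m, ae_eq_empty.2 hN.2⟩
  exact h1 A hA

theorem measurableSet_of_ae_eq {A B : Set Ω} (hm : negligibleSigma P ≤ m) (hmΩ : m ≤ mΩ)
    (hA : MeasurableSet A) (hB : MeasurableSet[m] B) (hAB : A =ᵐ[P] B) : MeasurableSet[m] A := by
  have hBΩ := hmΩ B hB
  have h1 := ae_eq_set.1 hAB
  have h2 : MeasurableSet[m] (A \ B) :=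
    hm _ (measurableSet_negligibleSigma (hA.diff hBΩ) h1.1)
  have h3 : MeasurableSet[m] (B \ A) :=
    hm _ (measurableSet_negligibleSigma (hBΩ.diff hA) h1.2)
  have h4 : A = (B \ (B \ A)) ∪ (A \ B) := by
    ext x; simp only [Set.mem_union, Set.mem_sdiff]; tauto
  rw [h4]
  exact (hB.diff h3).union h2

theorem measurable_of_ae_eq {Z : Type*} [MeasurableSpace Z] {f g : Ω → Z}
    (hm : negligibleSigma P ≤ m) (hmΩ : m ≤ mΩ) (hf : Measurable f) (hg : Measurable[m] g)
    (hfg : f =ᵐ[P] g) : Measurable[m] f :=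
  fun _ hC => measurableSet_of_ae_eq hm hmΩ (hf hC) (hg hC) (hfg.preimage _)

/-- A function measurable with respect to a σ-field augmented by the negligible events has a
version measurable with respect to the σ-field. -/
theorem exists_measurable_ae_eq {Z : Type*} [MeasurableSpace Z] [StandardBorelSpace Z]
    [Nonempty Z] {f : Ω → Z} (hf : Measurable[m ⊔ negligibleSigma P] f) :
    ∃ g : Ω → Z, Measurable[m] g ∧ f =ᵐ[P] g := by
  let := upgradeStandardBorel Z
  have hf' : StronglyMeasurable[m ⊔ negligibleSigma P] f := hf.stronglyMeasurable
  suffices ∃ g : Ω → Z, StronglyMeasurable[m] g ∧ f =ᵐ[P] g by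
    obtain ⟨g, hg, hfg⟩ := this
    exact ⟨g, hg.measurable, hfg⟩
  clear hf
  induction f, hf' using @StronglyMeasurable.induction' Ω Z (m ⊔ negligibleSigma P) _ _ with
  | const c => exact ⟨fun _ => c, stronglyMeasurable_const, EventuallyEq.rfl⟩
  | @pcw f g s hf hg hs h1 h2 =>
    obtain ⟨f', hf', hff⟩ := h1
    obtain ⟨g', hg', hgg⟩ := h2
    obtain ⟨s', hs', hss⟩ := exists_ae_eq_of_measurableSet_sup_negligibleSigma hs
    classical
    refine ⟨s'.piecewise f' g', hf'.piecewise hs' hg', ?_⟩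
    filter_upwards [hff, hgg, hss.mem_iff] with ω a b c
    by_cases h : ω ∈ s
    · simp [h, c.1 h, a]
    · simp [h, mt c.2 h, b]
  | @lim f g hf hg h1 h2 =>
    choose f' hf' hff using fun n => h1 n
    -- The versions `f' n` need not converge everywhere; `limUnder` is measurable all the same and
    -- gives the right limit off a null set.
    refine ⟨fun ω => limUnder atTop fun n => f' n ω, @StronglyMeasurable.limUnder _ _ _ m _ _ _ _ _ _ _ hf', ?_⟩
    filter_upwards [ae_all_iff.2 hff] with ω hω
    have h3 : Tendsto (fun n => f' n ω) atTop (𝓝 (g ω)) := by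
      simpa only [hω] using h2 ω
    exact h3.limUnder_eq.symm

/-- An almost sure limit of functions measurable with respect to a σ-field containing all
negligible events is measurable with respect to this σ-field. -/
theorem measurable_of_tendsto_ae_of_negligibleSigma_le {G : Type*} [TopologicalSpace G]
    [TopologicalSpace.PseudoMetrizableSpace G] [MeasurableSpace G] [BorelSpace G]
    (hm : negligibleSigma P ≤ m) (hmΩ : m ≤ mΩ) {Y : ℕ → Ω → G} {Z : Ω → G}
    (hY : ∀ n, Measurable[m] (Y n)) (hZ : Measurable Z)
    (h : ∀ᵐ ω ∂P, Tendsto (fun n => Y n ω) atTop (𝓝 (Z ω))) : Measurable[m] Z := by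
  classical
  rcases isEmpty_or_nonempty Ω with hΩ | ⟨⟨ω₀⟩⟩
  · exact fun C _ => (Set.eq_empty_of_isEmpty (Z ⁻¹' C)) ▸ @MeasurableSet.empty _ m
  obtain ⟨N, hN, hNm, hN0⟩ := exists_measurable_superset_of_null h
  have hNm' : MeasurableSet[m] N := hm _ (measurableSet_negligibleSigma hNm hN0)
  -- The exceptional null set belongs to `m`, so making all functions constant on it yields
  -- convergence everywhere without leaving `m`.
  have h1 : Measurable[m] (N.piecewise (fun _ => Z ω₀) Z) := by
    refine @measurable_of_tendsto_metrizable Ω G m _ _ _ _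
      (fun n => N.piecewise (fun _ => Z ω₀) (Y n)) _
      (fun n => Measurable.piecewise hNm' measurable_const (hY n)) (tendsto_pi_nhds.2 fun ω => ?_)
    by_cases hω : ω ∈ N
    · simpa [hω] using tendsto_const_nhds
    · simp only [hω, not_false_eq_true, Set.piecewise_eq_of_notMem]
      by_contra hcon
      exact hω (hN hcon)
  refine measurable_of_ae_eq hm hmΩ hZ h1 ?_
  have h2 : ∀ᵐ ω ∂P, ω ∉ N := measure_eq_zero_iff_ae_notMem.1 hN0
  filter_upwards [h2] with ω hω
  simp [hω]

end Negligible

/-! ### Flows at rational times -/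

/-- The values of a flow at rational times. -/
def ratFlow {Ω G : Type*} (X : ℝ → ℝ → Ω → G) (ω : Ω) (q : {q : ℚ × ℚ // q.1 < q.2}) : G :=
  X q.1.1 q.1.2 ω

/-- The approximating intervals contain `[s, t]`, since flows are continuous only from outside. -/
theorem exists_rat_approx {s t : ℝ} (hst : s < t) :
    ∃ q : ℕ → {q : ℚ × ℚ // q.1 < q.2}, (∀ n, ((q n).1.1 : ℝ) ≤ s) ∧ (∀ n, t ≤ (q n).1.2) ∧
      Tendsto (fun n => ((q n).1.1 : ℝ)) atTop (𝓝 s) ∧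
      Tendsto (fun n => ((q n).1.2 : ℝ)) atTop (𝓝 t) := by
  obtain ⟨a, -, ha, ha'⟩ := Real.exists_seq_rat_strictMono_tendsto s
  obtain ⟨b, -, hb, hb'⟩ := Real.exists_seq_rat_strictAnti_tendsto t
  have hab (n : ℕ) : a n < b n := by
    exact_mod_cast ((ha n).trans hst).trans (hb n)
  exact ⟨fun n => ⟨(a n, b n), hab n⟩, fun n => (ha n).le, fun n => (hb n).le, ha', hb'⟩

namespace IsFlowOn

variable {Ω G : Type*} [mΩ : MeasurableSpace Ω] [Monoid G] [mG : MeasurableSpace G]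
  {μ : ℝ → Measure G} {P : Measure Ω} {X : ℝ → ℝ → Ω → G}

theorem measurable_ratFlow (hX : IsFlowOn μ P X Set.univ) : Measurable (ratFlow X) :=
  measurable_pi_lambda _ fun q => hX.measurable _ trivial _ trivial (by exact_mod_cast q.2)

theorem measurable_comap_ratFlow [TopologicalSpace G] [BorelSpace G]
    [IsProbabilityMeasure P] (hG : IsTopoSemigroup G)
    (hμ : IsWeaklyContinuousConvolutionSemigroup μ) (hX : IsFlowOn μ P X Set.univ) {s t : ℝ}
    (hst : s < t) :
    Measurable[MeasurableSpace.pi.comap (ratFlow X) ⊔ negligibleSigma P] (X s t) := by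
  have := hG.metrizableSpace
  obtain ⟨q, h1, h2, h3, h4⟩ := exists_rat_approx hst
  obtain ⟨ns, -, hns⟩ := (hX.tendstoInProbability hG hμ hst h1 h2 h3 h4).exists_seq_tendsto_ae
  refine measurable_of_tendsto_ae_of_negligibleSigma_le le_sup_right
    (sup_le hX.measurable_ratFlow.comap_le negligibleSigma_le) (fun n => ?_)
    (hX.measurable _ trivial _ trivial hst) hns
  have h5 : Measurable[MeasurableSpace.pi.comap (ratFlow X)] fun ω => ratFlow X ω (q (ns n)) :=
    (measurable_pi_apply (q (ns n))).comp (comap_measurable (ratFlow X))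
  exact h5.mono le_sup_left le_rfl

/-- All values of a flow are functions of its values at rational times. -/
theorem exists_ae_eq_comp_ratFlow [TopologicalSpace G] [BorelSpace G]
    [IsProbabilityMeasure P] (hG : IsTopoSemigroup G)
    (hμ : IsWeaklyContinuousConvolutionSemigroup μ) (hX : IsFlowOn μ P X Set.univ) {s t : ℝ}
    (hst : s < t) : ∃ f : ({q : ℚ × ℚ // q.1 < q.2} → G) → G, Measurable f ∧
      X s t =ᵐ[P] fun ω => f (ratFlow X ω) := by
  have := hG.standardBorelSpace
  obtain ⟨g, hg, hXg⟩ := exists_measurable_ae_eq (hX.measurable_comap_ratFlow hG hμ hst)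
  obtain ⟨f, hf, rfl⟩ := hg.exists_eq_measurable_comp
  exact ⟨f, hf, hXg⟩

/-- A modification of the image of a flow under a measurable map is a flow. -/
theorem map [MeasurableEq G] [MeasurableMul₂ G] [IsProbabilityMeasure P]
    (hX : IsFlowOn μ P X Set.univ) {E : Type*} [MeasurableSpace E] {Φ : Ω → E} (hΦ : Measurable Φ)
    {X' : ℝ → ℝ → E → G} (hX' : ∀ s t, s < t → Measurable (X' s t))
    (h : ∀ s t, s < t → X s t =ᵐ[P] fun ω => X' s t (Φ ω)) :
    IsFlowOn μ (P.map Φ) X' Set.univ where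
  measurable s _ t _ hst := hX' s t hst
  law s _ t _ hst := by
    rw [Measure.map_map (hX' s t hst) hΦ, ← hX.law s trivial t trivial hst]
    exact Measure.map_congr (h s t hst).symm
  indep n τ _ hτ := by
    have hlt (i : Fin n) : τ i.castSucc < τ i.succ := hτ i.castSucc_lt_succ
    have hm (i : Fin n) : Measurable (X' (τ i.castSucc) (τ i.succ)) := hX' _ _ (hlt i)
    have := Measure.isProbabilityMeasure_map (μ := P) hΦ.aemeasurable
    have h1 : iIndepFun (fun (i : Fin n) ω => X' (τ i.castSucc) (τ i.succ) (Φ ω)) P :=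
      (hX.indep n τ (fun _ => trivial) hτ).congr fun i => h _ _ (hlt i)
    rw [iIndepFun_iff_map_fun_eq_pi_map fun i => (hm i).aemeasurable,
      Measure.map_map (measurable_pi_lambda _ hm) hΦ]
    simp_rw [Measure.map_map (hm _) hΦ]
    exact h1.map_fun_eq_pi_map fun i => ((hm i).comp hΦ).aemeasurable
  mul r _ s _ t _ hrs hst := by
    have hA : MeasurableSet {y | X' r t y = X' r s y * X' s t y} :=
      measurableSet_eq_fun (hX' r t (hrs.trans hst)) ((hX' r s hrs).mul (hX' s t hst))
    change ∀ᵐ y ∂(P.map Φ), X' r t y = X' r s y * X' s t y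
    rw [ae_map_iff hΦ.aemeasurable hA]
    filter_upwards [h _ _ hrs, h _ _ hst, h _ _ (hrs.trans hst),
      hX.mul r trivial s trivial t trivial hrs hst] with ω h1 h2 h3 h4
    rw [← h1, ← h2, ← h3, h4]

end IsFlowOn

/-- Existence of non-redundant stationary flows on standard probability spaces. -/
theorem exists_isStationaryFlow {G : Type u} [Monoid G] [TopologicalSpace G] [MeasurableSpace G]
    [BorelSpace G] (hG : IsTopoSemigroup G) {μ : ℝ → Measure G}
    (hμ : IsWeaklyContinuousConvolutionSemigroup μ) :
    ∃ (Ω : Type u) (_ : MeasurableSpace Ω) (_ : StandardBorelSpace Ω) (P : Measure Ω)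
      (_ : IsProbabilityMeasure P) (X : ℝ → ℝ → Ω → G),
      IsStationaryFlow μ P X ∧ IsNonredundant P X := by
  classical
  have := hG.standardBorelSpace
  have := hG.measurableMul₂
  obtain ⟨ν, hν, hX⟩ := exists_isFlowOn_univ hμ
  set X : ℝ → ℝ → ({p : ℝ × ℝ // p.1 < p.2} → G) → G :=
    fun s t x => if h : s < t then x ⟨(s, t), h⟩ else 1
  choose f hf hXf using fun (s t : ℝ) (hst : s < t) => hX.exists_ae_eq_comp_ratFlow hG hμ hst
  -- The uncountable power carrying `ν` need not be standard. The flow is therefore transported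
  -- along `ratFlow X` to a countable power, through which each `X s t` factors almost surely.
  let X' (s t : ℝ) : ({q : ℚ × ℚ // q.1 < q.2} → G) → G :=
    if h : s < t then f s t h else fun _ => 1
  have hX'm (s t : ℝ) (h : s < t) : Measurable (X' s t) := by
    simp only [X', h, dite_true]; exact hf s t h
  have hXX' (s t : ℝ) (h : s < t) : X s t =ᵐ[ν] fun ω => X' s t (ratFlow X ω) := by
    simp only [X', h, dite_true]; exact hXf s t h
  have hΦ := hX.measurable_ratFlow
  have := Measure.isProbabilityMeasure_map (μ := ν) hΦ.aemeasurable
  refine ⟨{q : ℚ × ℚ // q.1 < q.2} → G, inferInstance, inferInstance, ν.map (ratFlow X), this,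
    X', (hX.map hΦ hX'm hXX').isStationaryFlow hG hμ, le_antisymm ?_ ?_⟩
  · exact sup_le (iSup_le fun a => iSup_le fun b => iSup_le fun h => (hX'm a b h).comap_le)
      negligibleSigma_le
  -- Each coordinate is almost everywhere the value of `X'` at the corresponding rational pair,
  -- hence already in the generated σ-field.
  · refine iSup_le fun q => ?_
    have hq : (q.1.1 : ℝ) < q.1.2 := by exact_mod_cast q.2
    have hle : (⨆ (a : ℝ) (b : ℝ) (_ : a < b), MeasurableSpace.comap (X' a b) inferInstance) ⊔
        negligibleSigma (ν.map (ratFlow X)) ≤ MeasurableSpace.pi :=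
      sup_le (iSup_le fun a => iSup_le fun b => iSup_le fun h => (hX'm a b h).comap_le)
        negligibleSigma_le
    have h1 : Measurable[(⨆ (a : ℝ) (b : ℝ) (_ : a < b),
        MeasurableSpace.comap (X' a b) inferInstance) ⊔ negligibleSigma (ν.map (ratFlow X))]
        (X' q.1.1 q.1.2) := by
      have h2 : Measurable[MeasurableSpace.comap (X' q.1.1 q.1.2) inferInstance] (X' q.1.1 q.1.2) :=
        comap_measurable _
      refine h2.mono (le_trans ?_ le_sup_left) le_rfl
      exact le_iSup_of_le _ (le_iSup_of_le _ (le_iSup_of_le hq le_rfl))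
    refine (measurable_of_ae_eq le_sup_right hle (measurable_pi_apply q) h1 ?_).comap_le
    change ∀ᵐ y ∂(ν.map (ratFlow X)), y q = X' q.1.1 q.1.2 y
    rw [ae_map_iff hΦ.aemeasurable
      (measurableSet_eq_fun (measurable_pi_apply q) (hX'm _ _ hq))]
    exact hXX' _ _ hq

/-! ### Time shifts -/

namespace IsFlowOn

variable {Ω G : Type*} [mΩ : MeasurableSpace Ω] [Monoid G] [mG : MeasurableSpace G]
  {μ : ℝ → Measure G} {P : Measure Ω} {X : ℝ → ℝ → Ω → G}

theorem shift (hX : IsFlowOn μ P X Set.univ) (h : ℝ) :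
    IsFlowOn μ P (fun s t => X (s + h) (t + h)) Set.univ where
  measurable s _ t _ hst := hX.measurable _ trivial _ trivial (by linarith)
  law s _ t _ hst := by
    rw [hX.law _ trivial _ trivial (by linarith), add_sub_add_right_eq_sub]
  indep n τ _ hτ := hX.indep n (fun i => τ i + h) (fun _ => trivial) fun i j hij =>
    add_lt_add_left (hτ hij) h
  mul r _ s _ t _ hrs hst := hX.mul _ trivial _ trivial _ trivial (by linarith) (by linarith)

/-- Stationarity: increment laws depend only on `t - s`, so the shifted flow has the same
finite-dimensional laws, and these determine a law on the product. -/
theorem map_ratFlow_shift [MeasurableMul₂ G] [IsProbabilityMeasure P]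
    (hX : IsFlowOn μ P X Set.univ) (h : ℝ) :
    P.map (ratFlow fun s t => X (s + h) (t + h)) = P.map (ratFlow X) := by
  have hm := (hX.shift h).measurable_ratFlow
  have hm' := hX.measurable_ratFlow
  have h1 := Measure.isProbabilityMeasure_map (μ := P) hm.aemeasurable
  rw [map_eq_iff_forall_finset_map_restrict_eq hm.aemeasurable hm'.aemeasurable]
  intro I
  have h2 := (hX.shift h).map_eq_map hX (fun q : I => ((q.1.1.1 : ℝ), (q.1.1.2 : ℝ)))
    (fun q => Rat.cast_lt.2 q.1.2) (by simp) (by simp)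
  exact h2

end IsFlowOn

/-- A measure preserving map `T` shifts the flow `X` by `h`. -/
structure IsShift {Ω G : Type*} [MeasurableSpace Ω] (P : Measure Ω) (X : ℝ → ℝ → Ω → G) (h : ℝ)
    (T : Ω → Ω) : Prop where
  measurePreserving : MeasurePreserving T P P
  comp : ∀ s t, s < t → X s t ∘ T =ᵐ[P] X (s + h) (t + h)

namespace IsShift

variable {Ω G : Type*} [mΩ : MeasurableSpace Ω] {P : Measure Ω} {X : ℝ → ℝ → Ω → G}
  {T S : Ω → Ω} {h k : ℝ}

theorem zero : IsShift P X 0 fun ω => ω where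
  measurePreserving := MeasurePreserving.id P
  comp s t _ := by simp; rfl

theorem comp_shift (hT : IsShift P X h T) (hS : IsShift P X k S) :
    IsShift P X (h + k) fun ω => T (S ω) where
  measurePreserving := hT.measurePreserving.comp hS.measurePreserving
  comp s t hst := by
    have h1 := hS.measurePreserving.quasiMeasurePreserving.ae (hT.comp s t hst)
    filter_upwards [h1, hS.comp (s + h) (t + h) (by linarith)] with ω h2 h3
    simp only [Function.comp_apply] at h2 h3 ⊢
    rw [h2, h3, add_assoc, add_assoc]

theorem congr (hT : IsShift P X h T) (hS : MeasurePreserving S P P) (hST : S =ᵐ[P] T) :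
    IsShift P X h S where
  measurePreserving := hS
  comp s t hst := by
    filter_upwards [hT.comp s t hst, hST] with ω h1 h2
    simp only [Function.comp_apply] at h1 ⊢
    rw [h2, h1]

theorem ratFlow_ae_eq (hT : IsShift P X h T) :
    ∀ᵐ ω ∂P, ratFlow X (T ω) = ratFlow (fun s t => X (s + h) (t + h)) ω := by
  have h1 := ae_all_iff.2 fun q : {q : ℚ × ℚ // q.1 < q.2} =>
    hT.comp q.1.1 q.1.2 (by exact_mod_cast q.2)
  filter_upwards [h1] with ω hω
  exact funext hω

end IsShift

theorem MeasAut.measurePreserving_rep {Ω : Type*} [MeasurableSpace Ω] {P : Measure Ω}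
    (T : MeasAut P) : MeasurePreserving T.rep P P :=
  (Quotient.out T).measurePreserving_toFun

theorem MeasAut.eq_of_rep_ae_eq {Ω : Type*} [MeasurableSpace Ω] {P : Measure Ω} {S T : MeasAut P}
    (h : S.rep =ᵐ[P] T.rep) : S = T := by
  rw [← Quotient.out_eq S, ← Quotient.out_eq T]
  exact Quotient.sound h

section Shifts

variable {Ω G : Type*} [mΩ : MeasurableSpace Ω] [Monoid G] [TopologicalSpace G]
  [mG : MeasurableSpace G] [BorelSpace G] {μ : ℝ → Measure G} {P : Measure Ω}
  [IsProbabilityMeasure P] {X : ℝ → ℝ → Ω → G}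

theorem IsNonredundant.comap_ratFlow_sup (hX' : IsNonredundant P X) (hG : IsTopoSemigroup G)
    (hμ : IsWeaklyContinuousConvolutionSemigroup μ) (hX : IsFlowOn μ P X Set.univ) :
    MeasurableSpace.pi.comap (ratFlow X) ⊔ negligibleSigma P = mΩ := by
  refine le_antisymm (sup_le hX.measurable_ratFlow.comap_le negligibleSigma_le) ?_
  rw [IsNonredundant] at hX'
  conv_lhs => rw [← hX']
  exact sup_le (iSup_le fun a => iSup_le fun b => iSup_le fun hab =>
    (hX.measurable_comap_ratFlow hG hμ hab).comap_le) le_sup_right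

/-- The identity of `Ω` is measurable for the σ-field of rational values and negligible events. As
`Ω` is standard, it has a version that is a function of the rational values. -/
theorem IsNonredundant.exists_leftInverse [StandardBorelSpace Ω] (hX' : IsNonredundant P X)
    (hG : IsTopoSemigroup G) (hμ : IsWeaklyContinuousConvolutionSemigroup μ)
    (hX : IsFlowOn μ P X Set.univ) :
    ∃ Ψ : ({q : ℚ × ℚ // q.1 < q.2} → G) → Ω, Measurable Ψ ∧
      ∀ᵐ ω ∂P, Ψ (ratFlow X ω) = ω := by
  have := nonempty_of_isProbabilityMeasure P
  have h1 : Measurable[MeasurableSpace.pi.comap (ratFlow X) ⊔ negligibleSigma P, mΩ]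
      (id : Ω → Ω) := by
    rw [hX'.comap_ratFlow_sup hG hμ hX]
    exact measurable_id
  obtain ⟨g, hg, hXg⟩ := exists_measurable_ae_eq h1
  obtain ⟨Ψ, hΨ, rfl⟩ := hg.exists_eq_measurable_comp
  exact ⟨Ψ, hΨ, hXg.symm⟩

/-- The image of `ω` is recovered by `Ψ` from its rational flow values, and these are forced to be
the shifted values at `ω`. -/
theorem IsNonredundant.isShift_unique [StandardBorelSpace Ω] (hX' : IsNonredundant P X)
    (hG : IsTopoSemigroup G) (hμ : IsWeaklyContinuousConvolutionSemigroup μ)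
    (hX : IsFlowOn μ P X Set.univ) {S T : Ω → Ω} {h : ℝ} (hS : IsShift P X h S)
    (hT : IsShift P X h T) : S =ᵐ[P] T := by
  obtain ⟨Ψ, -, hΨ⟩ := hX'.exists_leftInverse hG hμ hX
  filter_upwards [hS.ratFlow_ae_eq, hT.ratFlow_ae_eq,
    hS.measurePreserving.quasiMeasurePreserving.ae hΨ,
    hT.measurePreserving.quasiMeasurePreserving.ae hΨ] with ω h1 h2 h3 h4
  rw [← h3, ← h4, h1, h2]

/-- The candidate is `Ψ` applied to the shifted rational values. Equality of the laws of the two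
flows makes it measure preserving and carries the identity `ratFlow X (Ψ y) = y` over to shifted
values. -/
theorem IsNonredundant.exists_isShift [StandardBorelSpace Ω] (hX' : IsNonredundant P X)
    (hG : IsTopoSemigroup G) (hμ : IsWeaklyContinuousConvolutionSemigroup μ)
    (hX : IsFlowOn μ P X Set.univ) (h : ℝ) : ∃ T : Ω → Ω, IsShift P X h T := by
  have := hG.metrizableSpace
  have := hG.measurableMul₂
  have := hG.standardBorelSpace
  obtain ⟨Ψ, hΨm, hΨ⟩ := hX'.exists_leftInverse hG hμ hX
  have hΦ := hX.measurable_ratFlow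
  have hΦh := (hX.shift h).measurable_ratFlow
  have hmap := hX.map_ratFlow_shift h
  have hid : P.map (fun ω => Ψ (ratFlow X ω)) = P := by
    rw [Measure.map_congr (g := id) hΨ, Measure.map_id]
  have hfix : ∀ᵐ ω ∂P, ratFlow X (Ψ (ratFlow (fun s t => X (s + h) (t + h)) ω)) =
      ratFlow (fun s t => X (s + h) (t + h)) ω := by
    have hE : MeasurableSet {y | ratFlow X (Ψ y) = y} :=
      measurableSet_eq_fun (hΦ.comp hΨm) measurable_id
    have h1 : ∀ᵐ y ∂(P.map (ratFlow X)), ratFlow X (Ψ y) = y := by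
      rw [ae_map_iff hΦ.aemeasurable hE]
      filter_upwards [hΨ] with ω hω
      rw [hω]
    rw [← hmap, ae_map_iff hΦh.aemeasurable hE] at h1
    exact h1
  have hT : MeasurePreserving (fun ω => Ψ (ratFlow (fun s t => X (s + h) (t + h)) ω)) P P := by
    refine ⟨hΨm.comp hΦh, ?_⟩
    have h1 := Measure.map_map (μ := P) hΨm hΦh
    rw [hmap, Measure.map_map hΨm hΦ] at h1
    exact h1.symm.trans hid
  refine ⟨_, hT, fun s t hst => ?_⟩
  -- Rational times are settled by `hfix`. For real `s` and `t` both sides are limits of the same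
  -- rational-time sequence along a common subsequence.
  obtain ⟨q, h1, h2, h3, h4⟩ := exists_rat_approx hst
  obtain ⟨a, ha, hXa⟩ := (hX.tendstoInProbability hG hμ hst h1 h2 h3 h4).exists_seq_tendsto_ae
  have h5 := (hX.shift h).tendstoInProbability hG hμ hst h1 h2 h3 h4
  obtain ⟨b, hb, hXb⟩ := (h5.comp ha.tendsto_atTop).exists_seq_tendsto_ae
  filter_upwards [hXb, hT.quasiMeasurePreserving.ae hXa, hfix] with ω h6 h7 h8
  refine tendsto_nhds_unique (h7.comp hb.tendsto_atTop) (h6.congr fun n => ?_)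
  exact (congrFun h8 (q (a (b n)))).symm

/-- Uniqueness turns an arbitrary choice of shifts into a homomorphism: two maps that shift by the
same amount agree almost everywhere. -/
theorem IsNonredundant.exists_isShift_comp [StandardBorelSpace Ω] (hX' : IsNonredundant P X)
    (hG : IsTopoSemigroup G) (hμ : IsWeaklyContinuousConvolutionSemigroup μ)
    (hX : IsFlowOn μ P X Set.univ) :
    ∃ T : Multiplicative ℝ →* MeasAut P,
      ∀ h : ℝ, IsShift P X h (T (Multiplicative.ofAdd h)).rep := by
  choose T hT using hX'.exists_isShift hG hμ hX
  have hinv (h : ℝ) : (fun ω => T (-h) (T h ω)) =ᵐ[P] fun ω => ω :=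
    hX'.isShift_unique hG hμ hX (by simpa using (hT (-h)).comp_shift (hT h)) .zero
  let f (h : ℝ) : PreAut P :=
    { toFun := T h
      invFun := T (-h)
      measurePreserving_toFun := (hT h).measurePreserving
      measurePreserving_invFun := (hT (-h)).measurePreserving
      left_inv := hinv h
      right_inv := by simpa using hinv (-h) }
  refine ⟨⟨⟨fun h => Quotient.mk _ (f h.toAdd), ?_⟩, ?_⟩, fun h => ?_⟩
  · exact Quotient.sound (hX'.isShift_unique hG hμ hX (hT 0) .zero)
  · intro h k
    exact Quotient.sound (hX'.isShift_unique hG hμ hX (hT (h.toAdd + k.toAdd))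
      ((hT h.toAdd).comp_shift (hT k.toAdd)))
  · have h1 : Quotient.out (Quotient.mk (PreAut.setoid P) (f h)) ≈ f h := Quotient.mk_out _
    exact (hT h).congr (MeasAut.measurePreserving_rep _) h1

end Shifts

/-! ### Measurability of maps into the automorphism group -/

namespace MeasAut

variable {Ω : Type*} [mΩ : MeasurableSpace Ω] {P : Measure Ω}

/-- The basic open sets given by approximation of preimages of `A` by `B`. -/
def approxSet (P : Measure Ω) (p : Set Ω × Set Ω × ℕ) : Set (MeasAut P) :=
  {T | P (symmDiff (T.rep ⁻¹' p.1) p.2.1) < ENNReal.ofReal (1 / (p.2.2 + 1))}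

theorem measure_symmDiff_preimage_rep (T : MeasAut P) {A B : Set Ω} (hA : MeasurableSet A)
    (hB : MeasurableSet B) : P (symmDiff (T.rep ⁻¹' A) (T.rep ⁻¹' B)) = P (symmDiff A B) :=
  T.measurePreserving_rep.measure_preimage (hA.symmDiff hB).nullMeasurableSet

/-- Both the event and its preimage can be approximated from `𝒜`. With `𝒜` countable this produces a
second countable topology at least as fine as the weak one. -/
theorem generateFrom_approxSet_le [IsProbabilityMeasure P] {𝒜 : Set (Set Ω)}
    (h𝒜 : P.MeasureDense 𝒜) :
    TopologicalSpace.generateFrom (approxSet P '' (𝒜 ×ˢ 𝒜 ×ˢ Set.univ)) ≤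
      (inferInstance : TopologicalSpace (MeasAut P)) := by
  refine le_generateFrom ?_
  rintro _ ⟨S, A, ε, hA, hε, rfl⟩
  let τ := TopologicalSpace.generateFrom (approxSet P '' (𝒜 ×ˢ 𝒜 ×ˢ Set.univ))
  refine (@isOpen_iff_mem_nhds _ τ _).2 fun T hT => ?_
  -- Four errors will be spent: replacing `A` by `B` under `T'` and under `T`, and comparing `C`
  -- with the preimage of `B` under each.
  obtain ⟨n, hn⟩ : ∃ n : ℕ, P (symmDiff (T.rep ⁻¹' A) (S.rep ⁻¹' A)) +
      4 * ENNReal.ofReal (1 / (n + 1)) < ε := by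
    have h1 : Tendsto (fun n : ℕ => P (symmDiff (T.rep ⁻¹' A) (S.rep ⁻¹' A)) +
        4 * ENNReal.ofReal (1 / (n + 1))) atTop
        (𝓝 (P (symmDiff (T.rep ⁻¹' A) (S.rep ⁻¹' A)) + 4 * ENNReal.ofReal 0)) :=
      (ENNReal.Tendsto.const_mul (ENNReal.tendsto_ofReal tendsto_one_div_add_atTop_nhds_zero_nat)
        (Or.inr (by simp))).const_add _
    rw [ENNReal.ofReal_zero, mul_zero, add_zero] at h1
    exact (h1.eventually_lt_const hT).exists
  have hpos : (0 : ℝ) < 1 / (n + 1) := by positivity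
  obtain ⟨B, hB, hAB⟩ := h𝒜.approx A hA (measure_ne_top _ _) _ hpos
  have hBm := h𝒜.measurable B hB
  obtain ⟨C, hC, hBC⟩ := h𝒜.approx (T.rep ⁻¹' B) (T.measurePreserving_rep.measurable hBm)
    (measure_ne_top _ _) _ hpos
  have hopen : @IsOpen _ τ (approxSet P (B, C, n)) :=
    TopologicalSpace.isOpen_generateFrom_of_mem ⟨_, ⟨hB, hC, trivial⟩, rfl⟩
  refine @Filter.mem_of_superset _ (@nhds _ τ T) _ _ (@IsOpen.mem_nhds _ τ T _ hopen hBC)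
    fun T' hT' => ?_
  set δ := ENNReal.ofReal (1 / (n + 1)) with hδ
  have h1 : P (symmDiff (T'.rep ⁻¹' A) (T'.rep ⁻¹' B)) ≤ δ := by
    rw [T'.measure_symmDiff_preimage_rep hA hBm]; exact hAB.le
  have h2 : P (symmDiff (T'.rep ⁻¹' B) C) ≤ δ := le_of_lt hT'
  have h3 : P (symmDiff C (T.rep ⁻¹' B)) ≤ δ := by rw [symmDiff_comm]; exact hBC.le
  have h4 : P (symmDiff (T.rep ⁻¹' B) (T.rep ⁻¹' A)) ≤ δ := by
    rw [T.measure_symmDiff_preimage_rep hBm hA, symmDiff_comm]; exact hAB.le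
  change P (symmDiff (T'.rep ⁻¹' A) (S.rep ⁻¹' A)) < ε
  calc P (symmDiff (T'.rep ⁻¹' A) (S.rep ⁻¹' A))
      ≤ δ + (δ + (δ + (δ + P (symmDiff (T.rep ⁻¹' A) (S.rep ⁻¹' A))))) :=
        (measure_symmDiff_le _ _ _).trans (add_le_add h1 ((measure_symmDiff_le _ _ _).trans
          (add_le_add h2 ((measure_symmDiff_le _ _ _).trans (add_le_add h3
            ((measure_symmDiff_le _ _ _).trans (add_le_add h4 le_rfl)))))))
    _ = P (symmDiff (T.rep ⁻¹' A) (S.rep ⁻¹' A)) + 4 * δ := by ring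
    _ < ε := hn

/-- A map into the automorphism group of a standard probability space is Borel measurable if it is
so after pairing with events. -/
theorem measurable_borel_of_measure_inter [StandardBorelSpace Ω] [IsProbabilityMeasure P]
    {α : Type*} [MeasurableSpace α] {f : α → MeasAut P}
    (hf : ∀ A B, MeasurableSet A → MeasurableSet B →
      Measurable fun a => P ((f a).rep ⁻¹' A ∩ B)) :
    Measurable[_, borel (MeasAut P)] f := by
  obtain ⟨𝒜, hc, h𝒜⟩ := exists_countable_measureDense P
  let τ := TopologicalSpace.generateFrom (approxSet P '' (𝒜 ×ˢ 𝒜 ×ˢ Set.univ))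
  have hτ : @SecondCountableTopology _ τ :=
    @SecondCountableTopology.mk _ τ
      ⟨_, (hc.prod (hc.prod Set.countable_univ)).image _, rfl⟩
  have h1 := @borel_eq_generateFrom_of_subbasis _ (approxSet P '' (𝒜 ×ˢ 𝒜 ×ˢ Set.univ)) τ hτ rfl
  -- The finer topology has more Borel sets, but they are generated by a countable subbasis, so only
  -- the sets `approxSet` need checking.
  refine Measurable.mono (?_ : Measurable[_, @borel _ τ] f) le_rfl
    (borel_anti (generateFrom_approxSet_le h𝒜))
  rw [h1]
  refine measurable_generateFrom ?_
  rintro _ ⟨⟨A, B, n⟩, ⟨hA, hB, -⟩, rfl⟩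
  have hA := h𝒜.measurable A hA
  have hB := h𝒜.measurable B hB
  have h2 : (fun a => P (symmDiff ((f a).rep ⁻¹' A) B)) =
      fun a => P ((f a).rep ⁻¹' A ∩ Bᶜ) + P ((f a).rep ⁻¹' Aᶜ ∩ B) := by
    funext a
    have hm := (f a).measurePreserving_rep.measurable hA
    rw [Set.symmDiff_def, measure_union (disjoint_sdiff_sdiff) (hB.diff hm),
      Set.sdiff_eq, Set.sdiff_eq, Set.inter_comm B]
    rfl
  have h3 : Measurable fun a => P (symmDiff ((f a).rep ⁻¹' A) B) := by
    rw [h2]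
    exact (hf A Bᶜ hA hB.compl).add (hf Aᶜ B hA.compl hB)
  exact h3 measurableSet_Iio

end MeasAut

/-! ### Measurability of the laws of shifted flows -/

theorem tendsto_intFloor_mul_div (x : ℝ) :
    Tendsto (fun n : ℕ => (⌊((n : ℝ) + 1) * x⌋ : ℝ) / (n + 1)) atTop (𝓝 x) := by
  have h1 : Tendsto (fun n : ℕ => x - 1 / ((n : ℝ) + 1)) atTop (𝓝 (x - 0)) :=
    tendsto_one_div_add_atTop_nhds_zero_nat.const_sub x
  rw [sub_zero] at h1
  refine tendsto_of_tendsto_of_tendsto_of_le_of_le h1 tendsto_const_nhds (fun n => ?_) fun n => ?_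
  · have hn : (0 : ℝ) < n + 1 := by positivity
    have := Int.sub_one_lt_floor (((n : ℝ) + 1) * x)
    simp only
    rw [le_div_iff₀ hn, sub_mul, one_div, inv_mul_cancel₀ hn.ne']
    linarith
  · have hn : (0 : ℝ) < n + 1 := by positivity
    simp only
    rw [div_le_iff₀ hn, mul_comm x]
    exact Int.floor_le _

theorem tendsto_intCeil_mul_div (x : ℝ) :
    Tendsto (fun n : ℕ => (⌈((n : ℝ) + 1) * x⌉ : ℝ) / (n + 1)) atTop (𝓝 x) := by
  have h := (tendsto_intFloor_mul_div (-x)).neg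
  simp_rw [mul_neg, Int.floor_neg] at h
  simpa [neg_div] using h

theorem exists_tendsto_ae_of_tendstoInProbability {Ω G ι : Type*} [MeasurableSpace Ω]
    {P : Measure Ω} [TopologicalSpace G] [TopologicalSpace.MetrizableSpace G] (I : Finset ι)
    {Y : ι → ℕ → Ω → G} {Z : ι → Ω → G} (h : ∀ i, TendstoInProbability P (Y i) (Z i)) {ns : ℕ → ℕ}
    (hns : Tendsto ns atTop atTop) :
    ∃ ms : ℕ → ℕ, Tendsto ms atTop atTop ∧
      ∀ i ∈ I, ∀ᵐ ω ∂P, Tendsto (fun n => Y i (ns (ms n)) ω) atTop (𝓝 (Z i ω)) := by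
  classical
  induction I using Finset.induction_on with
  | empty => exact ⟨id, tendsto_id, by simp⟩
  | insert i I _ ih =>
    obtain ⟨ms, hms, h1⟩ := ih
    obtain ⟨ks, hks, h2⟩ := ((h i).comp (hns.comp hms)).exists_seq_tendsto_ae
    refine ⟨ms ∘ ks, hms.comp hks.tendsto_atTop, fun j hj => ?_⟩
    rcases Finset.mem_insert.1 hj with rfl | hj
    · exact h2
    · filter_upwards [h1 j hj] with ω hω
      exact hω.comp hks.tendsto_atTop

namespace IsFlowOn

variable {Ω G : Type*} [mΩ : MeasurableSpace Ω] [Monoid G] [TopologicalSpace G]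
  [mG : MeasurableSpace G] [BorelSpace G] {μ : ℝ → Measure G} {P : Measure Ω}
  [IsProbabilityMeasure P] {X : ℝ → ℝ → Ω → G}

/-- Rounding the endpoints outward to multiples of `1 / (n + 1)` keeps the intervals on the side
where the flow is continuous; dominated convergence along subsequences then gives convergence for
every `h`. -/
theorem measurable_lintegral_shift (hG : IsTopoSemigroup G)
    (hμ : IsWeaklyContinuousConvolutionSemigroup μ) (hX : IsFlowOn μ P X Set.univ)
    {ι : Type*} [Fintype ι] (p : ι → ℝ × ℝ) (hp : ∀ i, (p i).1 < (p i).2)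
    (f : (ι → G) →ᵇ ℝ≥0) (B : Set Ω) :
    Measurable fun h : ℝ =>
      ∫⁻ ω, f (fun i => X ((p i).1 + h) ((p i).2 + h) ω) ∂(P.restrict B) := by
  have := hG.metrizableSpace
  have := hG.secondCountableTopology
  let lo (n : ℕ) (i : ι) (h : ℝ) : ℝ := (⌊((n : ℝ) + 1) * ((p i).1 + h)⌋ : ℝ) / (n + 1)
  let hi (n : ℕ) (i : ι) (h : ℝ) : ℝ := (⌈((n : ℝ) + 1) * ((p i).2 + h)⌉ : ℝ) / (n + 1)
  have hlo (n : ℕ) (i : ι) (h : ℝ) : lo n i h ≤ (p i).1 + h := by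
    have hn : (0 : ℝ) < n + 1 := by positivity
    simp only [lo]
    rw [div_le_iff₀ hn, mul_comm ((p i).1 + h)]
    exact Int.floor_le _
  have hhi (n : ℕ) (i : ι) (h : ℝ) : (p i).2 + h ≤ hi n i h := by
    have hn : (0 : ℝ) < n + 1 := by positivity
    simp only [hi]
    rw [le_div_iff₀ hn, mul_comm ((p i).2 + h)]
    exact Int.le_ceil _
  have hlt (i : ι) (h : ℝ) : (p i).1 + h < (p i).2 + h := by linarith [hp i]
  have hm (i : ι) (n : ℕ) (h : ℝ) : Measurable (X (lo n i h) (hi n i h)) :=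
    hX.measurable _ trivial _ trivial ((hlo n i h).trans_lt ((hlt i h).trans_le (hhi n i h)))
  have hconv (h : ℝ) (i : ι) : TendstoInProbability P (fun n => X (lo n i h) (hi n i h))
      (X ((p i).1 + h) ((p i).2 + h)) :=
    hX.tendstoInProbability hG hμ (hlt i h) (fun n => hlo n i h) (fun n => hhi n i h)
      (tendsto_intFloor_mul_div _) (tendsto_intCeil_mul_div _)
  refine measurable_of_tendsto_metrizable
    (f := fun n h => ∫⁻ ω, f (fun i => X (lo n i h) (hi n i h) ω) ∂(P.restrict B))
    (fun n => ?_) (tendsto_pi_nhds.2 fun h => tendsto_of_subseq_tendsto fun ns hns => ?_)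
  -- For fixed `n` the integral depends on `h` only through integers, and every function of these is
  -- measurable.
  · let g (k : ι → ℤ × ℤ) : ENNReal := ∫⁻ ω, f (fun i =>
      X (((k i).1 : ℝ) / (n + 1)) (((k i).2 : ℝ) / (n + 1)) ω) ∂(P.restrict B)
    have hg : Measurable g := Measurable.of_discrete
    exact hg.comp (f := fun (h : ℝ) i => (⌊((n : ℝ) + 1) * ((p i).1 + h)⌋,
      ⌈((n : ℝ) + 1) * ((p i).2 + h)⌉)) (by fun_prop)
  · obtain ⟨ms, -, h1⟩ := exists_tendsto_ae_of_tendstoInProbability Finset.univ (hconv h) hns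
    refine ⟨ms, tendsto_lintegral_of_dominated_convergence (fun _ => nndist f 0) (fun n => ?_)
      (fun n => ?_) ?_ ?_⟩
    · have h2 : Measurable fun ω i => X (lo (ns (ms n)) i h) (hi (ns (ms n)) i h) ω :=
        measurable_pi_lambda _ fun i => hm i _ h
      exact (f.continuous.measurable.comp h2).coe_nnreal_ennreal
    · refine Eventually.of_forall fun ω => ?_
      exact ENNReal.coe_le_coe.2 (BoundedContinuousFunction.NNReal.upper_bound f _)
    · simp [ENNReal.mul_eq_top]
    · refine ae_restrict_of_ae ?_
      have h2 := ae_all_iff.2 fun i => h1 i (Finset.mem_univ i)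
      filter_upwards [h2] with ω hω
      exact ENNReal.tendsto_coe.2 ((f.continuous.tendsto _).comp (tendsto_pi_nhds.2 hω))

/-- Thickened indicators pass from bounded continuous functions to closed sets, a π-system
generating the Borel σ-field. -/
theorem measurable_map_shift (hG : IsTopoSemigroup G)
    (hμ : IsWeaklyContinuousConvolutionSemigroup μ) (hX : IsFlowOn μ P X Set.univ)
    {ι : Type*} [Fintype ι] (p : ι → ℝ × ℝ) (hp : ∀ i, (p i).1 < (p i).2) (B : Set Ω) :
    Measurable fun h : ℝ =>
      (P.restrict B).map fun ω i => X ((p i).1 + h) ((p i).2 + h) ω := by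
  have := hG.metrizableSpace
  have := hG.secondCountableTopology
  let := TopologicalSpace.metrizableSpaceMetric (ι → G)
  have hm (h : ℝ) : Measurable fun ω i => X ((p i).1 + h) ((p i).2 + h) ω :=
    measurable_pi_lambda _ fun i =>
      hX.measurable _ trivial _ trivial (by linarith [hp i])
  refine Measurable.measure_of_isPiSystem (S := {F : Set (ι → G) | IsClosed F}) ?_
    isPiSystem_isClosed (fun F hF => ?_) ?_
  · rw [← borel_eq_generateFrom_isClosed]
    exact BorelSpace.measurable_eq
  · have hδ (n : ℕ) : (0 : ℝ) < 1 / (n + 1) := by positivity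
    refine measurable_of_tendsto_metrizable (fun n => ?_) (tendsto_pi_nhds.2 fun h =>
      tendsto_lintegral_thickenedIndicator_of_isClosed _ hF hδ
        tendsto_one_div_add_atTop_nhds_zero_nat)
    have h1 := hX.measurable_lintegral_shift hG hμ p hp (thickenedIndicator (hδ n) F) B
    convert h1 using 2 with h
    exact lintegral_map (BoundedContinuousFunction.continuous _).measurable.coe_nnreal_ennreal (hm h)
  · simp_rw [Measure.map_apply (hm _) MeasurableSet.univ]
    simp

theorem measurable_map_ratFlow_shift (hG : IsTopoSemigroup G)
    (hμ : IsWeaklyContinuousConvolutionSemigroup μ) (hX : IsFlowOn μ P X Set.univ) (B : Set Ω) :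
    Measurable fun h : ℝ =>
      (P.restrict B).map (ratFlow fun s t => X (s + h) (t + h)) := by
  have hm (h : ℝ) := (hX.shift h).measurable_ratFlow
  refine Measurable.measure_of_isPiSystem generateFrom_measurableCylinders.symm
    isPiSystem_measurableCylinders (fun C hC => ?_) ?_
  · obtain ⟨I, S, hS, rfl⟩ := (mem_measurableCylinders _).1 hC
    have h1 := hX.measurable_map_shift hG hμ (fun q : I => ((q.1.1.1 : ℝ), (q.1.1.2 : ℝ)))
      (fun q => Rat.cast_lt.2 q.1.2) B
    convert (Measure.measurable_coe hS).comp h1 using 2 with h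
    have h2 : Measurable fun ω (q : I) => X ((q.1.1.1 : ℝ) + h) ((q.1.1.2 : ℝ) + h) ω :=
      measurable_pi_lambda _ fun q => (measurable_pi_apply q.1).comp (hm h)
    simp only [Function.comp_apply]
    rw [Measure.map_apply (hm h) (MeasurableSet.cylinder _ hS), Measure.map_apply h2 hS]
    rfl
  · simp_rw [Measure.map_apply (hm _) MeasurableSet.univ]
    simp

end IsFlowOn

/-- The action of the time shifts is measurable. -/
theorem IsNonredundant.isMeasurableAction {Ω G : Type*} [mΩ : MeasurableSpace Ω]
    [StandardBorelSpace Ω] [Monoid G] [TopologicalSpace G] [mG : MeasurableSpace G] [BorelSpace G]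
    {μ : ℝ → Measure G} {P : Measure Ω} [IsProbabilityMeasure P] {X : ℝ → ℝ → Ω → G}
    (hX' : IsNonredundant P X) (hG : IsTopoSemigroup G)
    (hμ : IsWeaklyContinuousConvolutionSemigroup μ) (hX : IsFlowOn μ P X Set.univ)
    {T : Multiplicative ℝ →* MeasAut P}
    (hT : ∀ h : ℝ, IsShift P X h (T (Multiplicative.ofAdd h)).rep) : IsMeasurableAction T := by
  rw [IsMeasurableAction, ← BorelSpace.measurable_eq (α := ℝ)]
  refine MeasAut.measurable_borel_of_measure_inter fun A B hA hB => ?_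
  rw [← hX'.comap_ratFlow_sup hG hμ hX] at hA
  -- Up to a null set `A` says that the rational values lie in `C`; its preimage under the shift
  -- says the same of the shifted values.
  obtain ⟨_, ⟨C, hC, rfl⟩, hAC⟩ := exists_ae_eq_of_measurableSet_sup_negligibleSigma hA
  have h1 := (Measure.measurable_coe hC).comp (hX.measurable_map_ratFlow_shift hG hμ B)
  convert h1 using 2 with h
  have hm := (hX.shift h).measurable_ratFlow
  rw [Function.comp_apply, Measure.map_apply hm hC, Measure.restrict_apply (hm hC)]
  have h2 : (T (Multiplicative.ofAdd h)).rep ⁻¹' (ratFlow X ⁻¹' C) =ᵐ[P]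
      (ratFlow fun s t => X (s + h) (t + h)) ⁻¹' C :=
    (hT h).ratFlow_ae_eq.mono fun ω hω => by
      change (ratFlow X _ ∈ C) = (_ ∈ C)
      rw [hω]
  exact measure_congr
    ((((hT h).measurePreserving.quasiMeasurePreserving.preimage_ae_eq hAC).trans h2).inter
      EventuallyEq.rfl)

/-! ### The noise of a flow -/

theorem ProbabilityTheory.Indep.sup_negligibleSigma {Ω : Type*} {m₁ m₂ : MeasurableSpace Ω}
    [mΩ : MeasurableSpace Ω] {P : Measure Ω} (h : Indep m₁ m₂ P) :
    Indep (m₁ ⊔ negligibleSigma P) (m₂ ⊔ negligibleSigma P) P := by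
  rw [Indep_iff] at h ⊢
  intro A B hA hB
  obtain ⟨A', hA', hAA⟩ := exists_ae_eq_of_measurableSet_sup_negligibleSigma hA
  obtain ⟨B', hB', hBB⟩ := exists_ae_eq_of_measurableSet_sup_negligibleSigma hB
  rw [measure_congr (hAA.inter hBB), measure_congr hAA, measure_congr hBB, h A' B' hA' hB']

theorem comap_le_comap_pi {Ω G ι : Type*} [mG : MeasurableSpace G] (Y : ι → Ω → G) (i : ι) :
    mG.comap (Y i) ≤ MeasurableSpace.pi.comap fun ω j => Y j ω := by
  rintro _ ⟨C, hC, rfl⟩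
  exact ⟨_, measurable_pi_apply i hC, rfl⟩

section FlowSigma

variable {Ω G : Type*} [mΩ : MeasurableSpace Ω] [mG : MeasurableSpace G] {P : Measure Ω}
  {X : ℝ → ℝ → Ω → G}

theorem comap_le_flowSigma {s t a b : ℝ} (hs : s ≤ a) (hab : a < b) (ht : b ≤ t) :
    mG.comap (X a b) ≤ flowSigma P X s t :=
  le_sup_of_le_left (le_iSup_of_le a (le_iSup_of_le b (le_iSup_of_le ⟨hs, hab, ht⟩ le_rfl)))

theorem flowSigma_le_of {s t : ℝ} {m : MeasurableSpace Ω} (hm : @negligibleSigma Ω mΩ P ≤ m)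
    (h : ∀ a b, s ≤ a → a < b → b ≤ t → Measurable[m] (X a b)) :
    @flowSigma Ω mΩ G mG P X s t ≤ m :=
  sup_le (iSup_le fun a => iSup_le fun b => iSup_le fun hab =>
    (h a b hab.1 hab.2.1 hab.2.2).comap_le) hm

theorem measurable_flowSigma {s t a b : ℝ} (hs : s ≤ a) (hab : a < b) (ht : b ≤ t) :
    Measurable[flowSigma P X s t] (X a b) :=
  measurable_iff_comap_le.2 (comap_le_flowSigma hs hab ht)

theorem negligibleSigma_le_flowSigma {s t : ℝ} : negligibleSigma P ≤ flowSigma P X s t :=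
  le_sup_right

theorem flowSigma_mono {s t s' t' : ℝ} (hs : s' ≤ s) (ht : t ≤ t') :
    flowSigma P X s t ≤ flowSigma P X s' t' :=
  flowSigma_le_of le_sup_right fun _ _ h1 h2 h3 =>
    measurable_flowSigma (hs.trans h1) h2 (h3.trans ht)

theorem iSup_flowSigma (hX : ∀ s t, s < t → Measurable (X s t)) (hX' : IsNonredundant P X) :
    (⨆ (s : ℝ) (t : ℝ) (_ : s < t), flowSigma P X s t) = mΩ := by
  refine le_antisymm (iSup_le fun s => iSup_le fun t => iSup_le fun _ =>
    flowSigma_le_of negligibleSigma_le fun a b _ hab _ => hX a b hab) ?_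
  have h (s t : ℝ) (hst : s < t) : flowSigma P X s t ≤
      ⨆ (s : ℝ) (t : ℝ) (_ : s < t), flowSigma P X s t :=
    le_iSup_of_le s (le_iSup_of_le t (le_iSup_of_le hst le_rfl))
  rw [IsNonredundant] at hX'
  conv_lhs => rw [← hX']
  exact sup_le (iSup_le fun a => iSup_le fun b => iSup_le fun hab =>
    (comap_le_flowSigma le_rfl hab le_rfl).trans (h a b hab))
    (le_sup_right.trans (h 0 1 one_pos))

/-- Checked on generators: `X a b ∘ T` is a version of `X (a + h) (b + h)`, and `X a b` is a version
of `X (a - h) (b - h) ∘ T`. -/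
theorem IsShift.mapSigma_flowSigma (hX : ∀ s t, s < t → Measurable (X s t)) {T : MeasAut P}
    {h : ℝ} (hT : IsShift P X h T.rep) (s t : ℝ) :
    T.mapSigma (flowSigma P X s t) = flowSigma P X (s + h) (t + h) := by
  have hrep := hT.measurePreserving.measurable
  have hle (s t : ℝ) : flowSigma P X s t ≤ mΩ :=
    flowSigma_le_of negligibleSigma_le fun a b _ hab _ => hX a b hab
  refine le_antisymm (sup_le ?_ le_sup_right) (flowSigma_le_of le_sup_right fun a b hs hab ht => ?_)
  · rw [← measurable_iff_comap_le]
    refine measurable_iff_le_map.2 (flowSigma_le_of ?_ fun a b hs hab ht => ?_)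
    · refine MeasurableSpace.generateFrom_le fun N hN => ?_
      refine negligibleSigma_le_flowSigma _ (measurableSet_negligibleSigma (hrep hN.1) ?_)
      rw [hT.measurePreserving.measure_preimage hN.1.nullMeasurableSet, hN.2]
    · have h1 : Measurable[flowSigma P X (s + h) (t + h)] (X a b ∘ T.rep) :=
        measurable_of_ae_eq le_sup_right (hle _ _) ((hX a b hab).comp hrep)
          (measurable_flowSigma (by linarith) (by linarith) (by linarith)) (hT.comp a b hab)
      exact fun C hC => h1 hC
  · have h1 := hT.comp (a - h) (b - h) (by linarith)
    rw [sub_add_cancel, sub_add_cancel] at h1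
    have h2 : Measurable[(flowSigma P X s t).comap T.rep] (X (a - h) (b - h) ∘ T.rep) :=
      (measurable_flowSigma (P := P) (s := s) (t := t) (by linarith) (by linarith)
        (by linarith)).comp (comap_measurable _)
    refine measurable_of_ae_eq le_sup_right (sup_le ?_ negligibleSigma_le) (hX a b hab)
      (h2.mono le_sup_left le_rfl) h1.symm
    exact (MeasurableSpace.comap_mono (hle s t)).trans hrep.comap_le

end FlowSigma

namespace IsFlowOn

variable {Ω G : Type*} [mΩ : MeasurableSpace Ω] [Monoid G] [mG : MeasurableSpace G]
  [MeasurableMul₂ G] {μ : ℝ → Measure G} {P : Measure Ω} {X : ℝ → ℝ → Ω → G}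

/-- Independence of the whole past and future of `s` reduces to finite subfamilies; negligible
events do not affect it. -/
theorem indep_flowSigma [IsProbabilityMeasure P] (hX : IsFlowOn μ P X Set.univ) (r s t : ℝ) :
    Indep (flowSigma P X r s) (flowSigma P X s t) P := by
  refine Indep.sup_negligibleSigma ?_
  have h1 : IndepFun
      (fun ω (p : {p : ℝ × ℝ // p.1 < p.2 ∧ p.2 ≤ s}) => X p.1.1 p.1.2 ω)
      (fun ω (p : {p : ℝ × ℝ // s ≤ p.1 ∧ p.1 < p.2}) => X p.1.1 p.1.2 ω) P := by
    refine IndepFun.process_indepFun_process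
      (fun p => hX.measurable _ trivial _ trivial p.2.1)
      (fun p => hX.measurable _ trivial _ trivial p.2.2) fun I J => ?_
    exact hX.indepFun_of_le (fun p : I => p.1.1) (fun p : J => p.1.1) s (fun p => p.1.2.1)
      (fun p => p.1.2.2) (fun p => p.1.2.2) (fun p => p.1.2.1)
  rw [IndepFun_iff_Indep] at h1
  refine indep_of_indep_of_le_left (indep_of_indep_of_le_right h1 ?_) ?_
  · refine iSup_le fun a => iSup_le fun b => iSup_le fun h => ?_
    exact comap_le_comap_pi (fun (p : {p : ℝ × ℝ // s ≤ p.1 ∧ p.1 < p.2}) ω => X p.1.1 p.1.2 ω)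
      ⟨(a, b), h.1, h.2.1⟩
  · refine iSup_le fun a => iSup_le fun b => iSup_le fun h => ?_
    exact comap_le_comap_pi (fun (p : {p : ℝ × ℝ // p.1 < p.2 ∧ p.2 ≤ s}) ω => X p.1.1 p.1.2 ω)
      ⟨(a, b), h.2.1, h.2.2⟩

/-- Only an interval straddling `s` matters: the flow equation factors its value at `s` almost
surely, and the σ-fields contain the negligible events. -/
theorem flowSigma_sup (hX : IsFlowOn μ P X Set.univ) {r s t : ℝ} (hrs : r < s) (hst : s < t) :
    flowSigma P X r s ⊔ flowSigma P X s t = flowSigma P X r t := by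
  refine le_antisymm (sup_le (flowSigma_mono le_rfl hst.le) (flowSigma_mono hrs.le le_rfl))
    (flowSigma_le_of (negligibleSigma_le_flowSigma.trans le_sup_left) fun a b ha hab hb => ?_)
  have hm (a b : ℝ) (h : a < b) : Measurable (X a b) := hX.measurable a trivial b trivial h
  rcases le_or_gt b s with h1 | h1
  · exact (measurable_flowSigma (P := P) ha hab h1).mono le_sup_left le_rfl
  rcases le_or_gt s a with h2 | h2
  · exact (measurable_flowSigma (P := P) h2 hab hb).mono le_sup_right le_rfl
  have h3 : Measurable[flowSigma P X r s ⊔ flowSigma P X s t] (X a s) :=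
    (measurable_flowSigma ha h2 le_rfl).mono le_sup_left le_rfl
  have h4 : Measurable[flowSigma P X r s ⊔ flowSigma P X s t] (X s b) :=
    (measurable_flowSigma le_rfl h1 hb).mono le_sup_right le_rfl
  refine measurable_of_ae_eq (negligibleSigma_le_flowSigma.trans le_sup_left)
    (sup_le ?_ ?_) (hm a b hab) (h3.mul h4) (hX.mul a trivial s trivial b trivial h2 h1)
  all_goals exact flowSigma_le_of negligibleSigma_le fun a b _ hab _ => hm a b hab

end IsFlowOn

theorem IsNonredundant.isNoise {Ω G : Type*} [mΩ : MeasurableSpace Ω] [StandardBorelSpace Ω]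
    [Monoid G] [TopologicalSpace G] [mG : MeasurableSpace G] [BorelSpace G] {μ : ℝ → Measure G}
    {P : Measure Ω} [IsProbabilityMeasure P] {X : ℝ → ℝ → Ω → G} (hX' : IsNonredundant P X)
    (hG : IsTopoSemigroup G) (hμ : IsWeaklyContinuousConvolutionSemigroup μ)
    (hX : IsFlowOn μ P X Set.univ) {T : Multiplicative ℝ →* MeasAut P}
    (hT : ∀ h : ℝ, IsShift P X h (T (Multiplicative.ofAdd h)).rep) :
    IsNoise P (flowSigma P X) T := by
  have := hG.measurableMul₂
  have hm (a b : ℝ) (h : a < b) : Measurable (X a b) := hX.measurable a trivial b trivial h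
  exact
    { le := fun s t _ => flowSigma_le_of negligibleSigma_le fun a b _ hab _ => hm a b hab
      negligible_le := fun _ _ _ => negligibleSigma_le_flowSigma
      measurable_action := hX'.isMeasurableAction hG hμ hX hT
      indep := fun r s t _ _ => hX.indep_flowSigma r s t
      generate := fun _ _ _ hrs hst => hX.flowSigma_sup hrs hst
      shift := fun s t h _ => (hT h).mapSigma_flowSigma hm s t
      nonredundant := iSup_flowSigma hm hX' }

theorem mainTheorem9 {G : Type u} [Monoid G] [TopologicalSpace G] [MeasurableSpace G]
    [BorelSpace G] (hG : IsTopoSemigroup G) (μ : ℝ → Measure G)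
    (hμ : IsWeaklyContinuousConvolutionSemigroup μ) :
    (∃ (Ω : Type u) (_ : MeasurableSpace Ω) (_ : StandardBorelSpace Ω) (P : Measure Ω)
        (_ : IsProbabilityMeasure P) (X : ℝ → ℝ → Ω → G),
      IsStationaryFlow μ P X ∧ IsNonredundant P X) ∧
    (∀ (Ω : Type v) [MeasurableSpace Ω] [StandardBorelSpace Ω] (P : Measure Ω)
        [IsProbabilityMeasure P] (X : ℝ → ℝ → Ω → G),
      IsStationaryFlow μ P X → IsNonredundant P X →
        ∃! T : Multiplicative ℝ →* MeasAut P,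
          (∀ s t h : ℝ, s < t →
            X s t ∘ (T (Multiplicative.ofAdd h)).rep =ᵐ[P] X (s + h) (t + h)) ∧
          IsNoise P (flowSigma P X) T) := by
  refine ⟨exists_isStationaryFlow hG hμ, fun Ω _ _ P _ X hX hX' => ?_⟩
  have hF := hX.isFlowOn Set.univ
  obtain ⟨T, hT⟩ := hX'.exists_isShift_comp hG hμ hF
  refine ⟨T, ⟨fun s t h hst => (hT h).comp s t hst, hX'.isNoise hG hμ hF hT⟩, ?_⟩
  rintro S ⟨hS, -⟩
  refine MonoidHom.ext fun h => MeasAut.eq_of_rep_ae_eq ?_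
  exact hX'.isShift_unique hG hμ hF
    ⟨MeasAut.measurePreserving_rep _, fun s t hst => hS s t h.toAdd hst⟩ (hT h.toAdd)
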